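/- Consider $N$ fermionic modes (spin-orbitals) with annihilation operators $c_j$, Majorana operators $\gamma_{2j}=c_j+c_j^\dagger$, $\gamma_{2j+1}=i(c_j^\dagger-c_j)$, and Fock space identified with $N$ qubits through occupation numbers (Jordan–Wigner). A state $\rho$ is a density operator on Fock space respecting fermion parity. The elements of the fermionic $k$-RDM are the numbers $\mathrm{Tr}(\rho\,c^\dagger_{p_1}\cdots c^\dagger_{p_k}c_{q_1}\cdots c_{q_k})$; a $2k$-Majorana operator is $i^k$ times a product of $2k$ distinct Majorana operators. A Clifford protocol with $M$ preparations receives $M$ copies of an unknown $\rho$ one at a time, adds any number of ancilla qubits in $|0\rangle$ to each copy, applies a Clifford unitary (chosen possibly at random and depending on earlier readouts), reads out all qubits in the computational basis, and finally computes an estimate of each element of a given list of expectation values from all readouts. It is accurate to error $\epsilon$ if, for every state $\rho$ and every element of the list, either (i) the estimate is within $\epsilon$ of the true value with probability at least $p$, where $p>1/2$ is fixed, or (ii) the root-mean-square error of the estimate is at most $\epsilon$ (one of the two criteria being used for all states and elements). **Theorem.** (a) For every $k\ge1$ and $p>1/2$ there are $c,\epsilon_0>0$, depending only on $k$ and $p$,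 such that for all $N\ge k$ and $0<\epsilon\le\epsilon_0$, every Clifford protocol that is accurate to error $\epsilon$ for all elements of the fermionic $k$-RDM uses $M\ge c\,\epsilon^{-2}N^k$ preparations; that is, in the worst case $\Omega(\epsilon^{-2}N^k)$ preparations are needed. The same holds for protocols that estimate the expectation values of all $2k$-Majorana operators. (b) If a finite family of sets of mutually commuting operators (cliques) contains all $2$-Majorana operators, it has at least $2N-1$ members; if $N\ge8$ and it contains all $4$-Majorana operators, it has at least $\frac43N^2-\frac83N+1$ members. (c) Say that a circuit measures a $2k$-Majorana operator if, up to sign, that operator is the observable on the system given by the parity of some subset of the read-out bits. The $2k$-Majorana operators measured by one circuit commute with each other; they are the clique measured by the circuit. A Clifford protocol accurate to some error $0\le\epsilon<\frac14$ for all elements of the $1$-RDM measures, over all its possible runs, at least $2N-1$ distinct cliques of $2$-Majorana operators; if $N\ge8$, one accurate to some error $0\le\epsilon<\frac1{16}$ for all elements of the $2$-RDM measures at least $\frac43N^2-\frac83N+1$ distinct cliques of $4$-Majorana operators. -/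

import Mathlib

open scoped Matrix ENNReal ComplexOrder

noncomputable section

namespace FermionTomography

/-! ### Qubits, Pauli strings, Clifford unitaries -/

/-- Linear operators on the qubits labelled by `Q`, as complex matrices in the computational basis,
whose elements are the bit strings `Q → Bool` (`true` is the state `1`). -/
abbrev Operator (Q : Type) : Type := Matrix (Q → Bool) (Q → Bool) ℂ

/-- The four single-qubit Pauli matrices. -/
inductive PauliLetter : Type
  | I | X | Y | Z

/-- The `2 × 2` matrix of a Pauli letter; row and column indices are `false = 0`, `true = 1`. -/
def PauliLetter.toMatrix : PauliLetter → Matrix Bool Bool ℂ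
  | .I => Matrix.of fun x y => if x = y then 1 else 0
  | .X => Matrix.of fun x y => if x = y then 0 else 1
  | .Y => Matrix.of fun x y => if x = y then 0 else if x then Complex.I else -Complex.I
  | .Z => Matrix.of fun x y => if x = y then (if x then -1 else 1) else 0

/-- The tensor product of single-qubit Pauli matrices. -/
def pauliString {Q : Type} [Fintype Q] (s : Q → PauliLetter) : Operator Q :=
  Matrix.of fun x y => ∏ q, (s q).toMatrix (x q) (y q)

/-- A Clifford unitary: a unitary that conjugates every Pauli string into the Pauli group
`{i ^ j P : j ∈ ℕ, P a Pauli string}`. -/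
def IsClifford {Q : Type} [Fintype Q] [DecidableEq Q] (U : Operator Q) : Prop :=
  U ∈ Matrix.unitaryGroup (Q → Bool) ℂ ∧
    ∀ s : Q → PauliLetter, ∃ (j : ℕ) (s' : Q → PauliLetter),
      U * pauliString s * Uᴴ = Complex.I ^ j • pauliString s'

/-- The Clifford unitaries on `N` system qubits and `a` ancilla qubits. -/
abbrev CliffordCircuit (N a : ℕ) : Type :=
  {U : Operator (Fin N ⊕ Fin a) // IsClifford U}

/-! ### Fermions -/

/-- The annihilation operator `c_j` on the Fock space of `N` fermionic modes.  The basis vectors are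
the occupation strings `Fin N → Bool`, which are also the computational basis of `N` qubits (the
Jordan–Wigner identification): `c_j |y⟩ = 0` if mode `j` is empty in `y`, and otherwise
`c_j |y⟩ = (-1) ^ (number of occupied modes before j) |y with mode j emptied⟩`. -/
def annihilation {N : ℕ} (j : Fin N) : Operator (Fin N) :=
  Matrix.of fun x y =>
    if y j = true ∧ x = Function.update y j false then
      (-1) ^ (Finset.univ.filter fun i : Fin N => i < j ∧ y i = true).card
    else 0

/-- The creation operator `c_j†`. -/
def creation {N : ℕ} (j : Fin N) : Operator (Fin N) := (annihilation j)ᴴ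

/-- The Majorana operators `γ_{2j} = c_j + c_j†` and `γ_{2j+1} = i (c_j† - c_j)`. -/
def majorana {N : ℕ} (i : Fin (2 * N)) : Operator (Fin N) :=
  have hi : i.val / 2 < N := by have := i.isLt; omega
  if i.val % 2 = 0 then
    annihilation ⟨i.val / 2, hi⟩ + creation ⟨i.val / 2, hi⟩
  else
    Complex.I • (creation ⟨i.val / 2, hi⟩ - annihilation ⟨i.val / 2, hi⟩)

/-- Labels of the `2k`-Majorana operators: sets of `2k` distinct Majorana indices. -/
abbrev MajoranaIndex (N k : ℕ) : Type := {T : Finset (Fin (2 * N)) // T.card = 2 * k}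

/-- The `2k`-Majorana operator `i ^ k γ_{j_1} ⋯ γ_{j_{2k}}`, `j_1 < ⋯ < j_{2k}`; the phase makes it
Hermitian. -/
def majoranaOp {N k : ℕ} (T : MajoranaIndex N k) : Operator (Fin N) :=
  Complex.I ^ k • ((T.1.sort (· ≤ ·)).map majorana).prod

/-- Labels of the elements of the fermionic `k`-RDM. -/
abbrev RDMIndex (N k : ℕ) : Type := (Fin k → Fin N) × (Fin k → Fin N)

/-- The operator `c†_{p_1} ⋯ c†_{p_k} c_{q_1} ⋯ c_{q_k}`, whose expectation value is an element of
the fermionic `k`-RDM. -/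
def rdmOp {N k : ℕ} (e : RDMIndex N k) : Operator (Fin N) :=
  (List.ofFn fun i => creation (e.1 i)).prod * (List.ofFn fun i => annihilation (e.2 i)).prod

/-- The parity `(-1) ^ (number of occupied modes)` of an occupation string. -/
def fermionParity {N : ℕ} (x : Fin N → Bool) : ℤ :=
  (-1) ^ (Finset.univ.filter fun i : Fin N => x i = true).card

/-- A state of `N` fermionic modes: a density operator that respects the fermion parity
superselection rule.  (Accuracy below is demanded on these states only; demanding it on all density
operators would ask more of an estimation protocol, and so give a weaker lower bound.) -/
structure IsFermionState {N : ℕ} (ρ : Operator (Fin N)) : Prop where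
  posSemidef : ρ.PosSemidef
  trace_eq_one : ρ.trace = 1
  even : ∀ x y, fermionParity x ≠ fermionParity y → ρ x y = 0

/-- The expectation value `Tr (ρ O)`. -/
def expectation {N : ℕ} (ρ O : Operator (Fin N)) : ℂ := (ρ * O).trace

/-! ### One preparation: Clifford circuit and computational-basis readout -/

/-- Results of reading out all `N + a` qubits in the computational basis. -/
abbrev Outcome (N a : ℕ) : Type := Fin N ⊕ Fin a → Bool

/-- `ρ ⊗ |0⟩⟨0|`: the state `ρ` together with `a` ancilla qubits in the state `|0⟩`. -/
def withAncillas {N : ℕ} (a : ℕ) (ρ : Operator (Fin N)) : Operator (Fin N ⊕ Fin a) :=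
  Matrix.of fun x y =>
    if ∀ i : Fin a, x (Sum.inr i) = false ∧ y (Sum.inr i) = false then
      ρ (fun i => x (Sum.inl i)) (fun i => y (Sum.inl i))
    else 0

/-- The probability `⟨z| U (ρ ⊗ |0⟩⟨0|) U† |z⟩` of reading `z`. -/
def CliffordCircuit.prob {N a : ℕ} (U : CliffordCircuit N a) (ρ : Operator (Fin N))
    (z : Outcome N a) : ℝ :=
  ((U.1 * withAncillas a ρ * U.1ᴴ) z z).re

/-- The observable on the system whose expectation value in `ρ` is that of the parity
`∏_{q ∈ S} Z_q` of the readout: `(1 ⊗ ⟨0|) U† (∏_{q ∈ S} Z_q) U (1 ⊗ |0⟩)`. -/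
def CliffordCircuit.readout {N a : ℕ} (U : CliffordCircuit N a) (S : Finset (Fin N ⊕ Fin a)) :
    Operator (Fin N) :=
  Matrix.of fun x y =>
    (U.1ᴴ * pauliString (fun q => if q ∈ S then PauliLetter.Z else PauliLetter.I) * U.1)
      (Sum.elim x fun _ => false) (Sum.elim y fun _ => false)

/-- The clique of `2k`-Majorana operators that the circuit measures: those that coincide, up to
sign, with a parity of the readout. -/
def CliffordCircuit.clique {N a : ℕ} (k : ℕ) (U : CliffordCircuit N a) : Set (Operator (Fin N)) :=
  {G | (∃ T : MajoranaIndex N k, G = majoranaOp T) ∧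
    ∃ S : Finset (Fin N ⊕ Fin a), U.readout S = G ∨ U.readout S = -G}

/-! ### Estimation protocols -/

/-- A deterministic protocol that consumes `M` preparations of the unknown state, one at a time, and
outputs an estimate for each label in `ι`.  The circuit applied to a preparation may depend on all
earlier readouts (listed in order). -/
structure DetProtocol (N M : ℕ) (ι : Type) : Type where
  /-- number of ancilla qubits -/
  ancillas : ℕ
  /-- the circuit applied next, given the list of earlier readouts -/
  circuit : List (Outcome N ancillas) → CliffordCircuit N ancillas
  /-- classical post-processing of all readouts -/
  estimate : (Fin M → Outcome N ancillas) → ι → ℂ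

/-- The circuit applied to preparation number `t` in a run with readouts `x`. -/
def DetProtocol.circuitAt {N M : ℕ} {ι : Type} (D : DetProtocol N M ι)
    (x : Fin M → Outcome N D.ancillas) (t : Fin M) : CliffordCircuit N D.ancillas :=
  D.circuit ((List.ofFn x).take t)

/-- The probability of the sequence of readouts `x` when every preparation is in the state `ρ`. -/
def DetProtocol.law {N M : ℕ} {ι : Type} (D : DetProtocol N M ι) (ρ : Operator (Fin N))
    (x : Fin M → Outcome N D.ancillas) : ℝ :=
  ∏ t : Fin M, (D.circuitAt x t).prob ρ (x t)

/-- A protocol that may also use classical randomness: a probability distribution on deterministic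
protocols. -/
abbrev Protocol (N M : ℕ) (ι : Type) : Type := PMF (DetProtocol N M ι)

/-- Expected value of a nonnegative function of the run, when the unknown state is `ρ`. -/
def Protocol.mean {N M : ℕ} {ι : Type} (A : Protocol N M ι) (ρ : Operator (Fin N))
    (f : (D : DetProtocol N M ι) → (Fin M → Outcome N D.ancillas) → ℝ≥0∞) : ℝ≥0∞ :=
  ∑' D, A D * ∑ x, ENNReal.ofReal (D.law ρ x) * f D x

open Classical in
/-- For every state and every label `e`, the estimate is within `ε` of `Tr (ρ O_e)` with probability
at least `p`. -/
def Protocol.AccurateWithProb {N M : ℕ} {ι : Type} (A : Protocol N M ι)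
    (O : ι → Operator (Fin N)) (ε p : ℝ) : Prop :=
  ∀ ρ, IsFermionState ρ → ∀ e : ι,
    ENNReal.ofReal p ≤
      A.mean ρ fun D x => if ‖D.estimate x e - expectation ρ (O e)‖ ≤ ε then 1 else 0

/-- For every state and every label `e`, the root-mean-square error of the estimate of `Tr (ρ O_e)`
is at most `ε`. -/
def Protocol.AccurateInRMS {N M : ℕ} {ι : Type} (A : Protocol N M ι)
    (O : ι → Operator (Fin N)) (ε : ℝ) : Prop :=
  ∀ ρ, IsFermionState ρ → ∀ e : ι,
    A.mean ρ (fun D x => ENNReal.ofReal (‖D.estimate x e - expectation ρ (O e)‖ ^ 2)) ≤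
      ENNReal.ofReal (ε ^ 2)

/-- The distinct cliques of `2k`-Majorana operators that are measured by the circuits which occur
with positive probability, on some state, in a run of the protocol. -/
def Protocol.measuredCliques {N M : ℕ} {ι : Type} (k : ℕ) (A : Protocol N M ι) :
    Set (Set (Operator (Fin N))) :=
  {K | ∃ D ∈ A.support, ∃ (ρ : Operator (Fin N)) (x : Fin M → Outcome N D.ancillas) (t : Fin M),
    IsFermionState ρ ∧ 0 < D.law ρ x ∧ K = (D.circuitAt x t).clique k}

/-- The sets in `𝒞` consist of mutually commuting operators, and every `2k`-Majorana operator
belongs to one of them. -/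
def IsCommutingCliqueCover {N : ℕ} (k : ℕ) (𝒞 : Finset (Set (Operator (Fin N)))) : Prop :=
  (∀ C ∈ 𝒞, C.Pairwise Commute) ∧ ∀ T : MajoranaIndex N k, ∃ C ∈ 𝒞, majoranaOp T ∈ C

end FermionTomography

end

/-!
# Lower bounds for Clifford tomography of fermionic reduced density matrices

The argument rests on what one Clifford circuit with computational-basis readout can see.

*One circuit measures one commuting clique.* By the Jordan–Wigner form every Majorana operator is a
multiple of a Pauli string. If such an operator `G` is not, up to sign, a parity of the readout, then
conjugating `G ⊗ |0⟩⟨0|` by the circuit gives a combination of Pauli strings with vanishing diagonal,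
so `G` does not enter the readout statistics (`CliffordCircuit.prob_majoranaOp_eq_zero`). The
operators that are parities of the readout commute (`CliffordCircuit.clique_pairwise_commute`).

*Commuting cliques are small.* Two Majorana operators of even degree commute only if their index sets
meet in an even number of points (`even_inter_of_commute`). A family of `2 k`-subsets of a
`2 N`-element set with pairwise even intersections has at most `(2 N) ^ k` members
(`card_le_pow_of_even_inter`), at most `N` if `k = 1`, and at most `N (N - 1) / 2` if `k = 2` and
`N ≥ 8`: the sets through a point become triples meeting pairwise in one point, and these share a
point or number at most seven (`card_triples_le`). Dividing `(2 N).choose (2 k)` by these numbers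
bounds the size of a cover by commuting cliques.

*Test states.* The states `(1 + δ G_T) / 2 ^ N` differ from the maximally mixed state in the single
Majorana expectation value of `G_T`. Some element of the `k`-RDM has a component of modulus at least
`4 ^ (-k)` along `G_T` (`exists_rdm_component`), so an accurate protocol has to tell these states
apart.

*Number of cliques.* With `δ = 1` and `δ = -1`, a protocol none of whose circuits measures `G_T` has
the same readout distribution on both states (`Protocol.mean_eq_of_not_measured`). Hence the measured
cliques cover all Majorana operators.

*Number of preparations.* With `δ` of order `ε`, a preparation contributes to the squared Hellinger
distance between the readouts of `(1 + δ G_T) / 2 ^ N` and of the maximally mixed state at most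
order `δ ^ 2`, and only if its circuit measures `G_T`. Summed over all `T`, of which there are of
order `N ^ (2 k)`, a preparation contributes at most order `δ ^ 2 N ^ k`, whatever the earlier readouts
were (`sum_success_le`). The total must be of order `N ^ (2 k)`, so that `M` is at least of order
`ε ^ (-2) N ^ k` (`preparations_ge`).
-/

namespace FermionTomography

/-! ### Tensor products of one-qubit operators -/

/-- The tensor product `⨂_q B q` of one-qubit operators, as a matrix in the computational basis. -/
def tensor {Q : Type} [Fintype Q] (B : Q → Matrix Bool Bool ℂ) : Operator Q :=
  Matrix.of fun x y => ∏ q, B q (x q) (y q)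

section Tensor

variable {Q : Type} [Fintype Q]

theorem tensor_apply (B : Q → Matrix Bool Bool ℂ) (x y : Q → Bool) :
    tensor B x y = ∏ q, B q (x q) (y q) := rfl

theorem tensor_mul [DecidableEq Q] (B C : Q → Matrix Bool Bool ℂ) :
    tensor B * tensor C = tensor fun q => B q * C q := by
  ext x y
  simp only [Matrix.mul_apply, tensor_apply, ← Finset.prod_mul_distrib]
  rw [Finset.prod_univ_sum, Fintype.piFinset_univ]

theorem tensor_one : tensor (fun _ : Q => 1) = 1 := by
  ext x y
  rw [tensor_apply, Matrix.one_apply]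
  split_ifs with h
  · subst h; simp
  · obtain ⟨q, hq⟩ := Function.ne_iff.mp h
    exact Finset.prod_eq_zero (Finset.mem_univ q) (Matrix.one_apply_ne hq)

theorem tensor_conjTranspose (B : Q → Matrix Bool Bool ℂ) :
    (tensor B)ᴴ = tensor fun q => (B q)ᴴ := by
  ext x y
  simp [tensor_apply, Matrix.conjTranspose_apply]

theorem trace_tensor [DecidableEq Q] (B : Q → Matrix Bool Bool ℂ) :
    (tensor B).trace = ∏ q, (B q).trace := by
  simp only [Matrix.trace, Matrix.diag, tensor_apply]
  rw [Finset.prod_univ_sum, Fintype.piFinset_univ]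

theorem tensor_smul (c : Q → ℂ) (B : Q → Matrix Bool Bool ℂ) :
    tensor (fun q => c q • B q) = (∏ q, c q) • tensor B := by
  ext x y
  simp [tensor_apply, Finset.prod_mul_distrib]

/-- Two tensor products that anticommute at exactly one site, and commute at all the others,
anticommute. -/
theorem tensor_anticomm [DecidableEq Q] {B C : Q → Matrix Bool Bool ℂ} (j : Q)
    (hj : B j * C j = -(C j * B j)) (h : ∀ q, q ≠ j → B q * C q = C q * B q) :
    tensor B * tensor C = -(tensor C * tensor B) := by
  have key : (fun q => B q * C q) = fun q => (if q = j then (-1 : ℂ) else 1) • (C q * B q) := by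
    funext q
    by_cases hq : q = j
    · subst hq; simp [hj]
    · simp [hq, h q hq]
  rw [tensor_mul, key, tensor_smul, ← tensor_mul]
  simp

theorem tensor_update_add [DecidableEq Q] (F : Q → Matrix Bool Bool ℂ) (j : Q) (B C : Matrix Bool Bool ℂ) :
    tensor (Function.update F j (B + C)) =
      tensor (Function.update F j B) + tensor (Function.update F j C) := by
  ext x y
  simp only [tensor_apply, Matrix.add_apply,
    Function.apply_update (fun q (M : Matrix Bool Bool ℂ) => M (x q) (y q)),
    Finset.prod_update_of_mem (Finset.mem_univ j), add_mul]

theorem tensor_update_smul [DecidableEq Q] (F : Q → Matrix Bool Bool ℂ) (j : Q) (c : ℂ) (B : Matrix Bool Bool ℂ) :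
    tensor (Function.update F j (c • B)) = c • tensor (Function.update F j B) := by
  ext x y
  simp only [tensor_apply, Matrix.smul_apply, smul_eq_mul,
    Function.apply_update (fun q (M : Matrix Bool Bool ℂ) => M (x q) (y q)),
    Finset.prod_update_of_mem (Finset.mem_univ j), mul_assoc]

end Tensor

/-! ### Pauli strings -/

theorem PauliLetter.exists_mul (a b : PauliLetter) :
    ∃ (w : ℂ) (c : PauliLetter), w ≠ 0 ∧ a.toMatrix * b.toMatrix = w • c.toMatrix := by
  refine ⟨match a, b with
    | .X, .Y | .Y, .Z | .Z, .X => Complex.I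
    | .Y, .X | .Z, .Y | .X, .Z => -Complex.I
    | _, _ => 1,
    match a, b with
    | .I, c | c, .I => c
    | .X, .X | .Y, .Y | .Z, .Z => .I
    | .X, .Y | .Y, .X => .Z
    | .Y, .Z | .Z, .Y => .X
    | .Z, .X | .X, .Z => .Y, ?_, ?_⟩
  · cases a <;> cases b <;> simp
  · cases a <;> cases b <;> ext x y <;> cases x <;> cases y <;> simp [toMatrix, Matrix.mul_apply]

theorem PauliLetter.mul_self (a : PauliLetter) : a.toMatrix * a.toMatrix = 1 := by
  cases a <;> ext x y <;> cases x <;> cases y <;> simp [toMatrix, Matrix.mul_apply]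

theorem PauliLetter.conjTranspose (a : PauliLetter) : a.toMatrixᴴ = a.toMatrix := by
  cases a <;> ext x y <;> cases x <;> cases y <;> simp [toMatrix, Matrix.conjTranspose_apply]

theorem PauliLetter.toMatrix_I : PauliLetter.I.toMatrix = 1 := by
  ext x y; cases x <;> cases y <;> simp [toMatrix]

theorem pauliString_eq_tensor {Q : Type} [Fintype Q] (s : Q → PauliLetter) :
    pauliString s = tensor fun q => (s q).toMatrix := rfl

theorem pauliString_mul_self {Q : Type} [Fintype Q] [DecidableEq Q] (s : Q → PauliLetter) :
    pauliString s * pauliString s = 1 := by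
  rw [pauliString_eq_tensor, tensor_mul, ← tensor_one]
  simp only [PauliLetter.mul_self]

/-- A nonzero multiple of a Pauli string. -/
def IsPauli {Q : Type} [Fintype Q] (A : Operator Q) : Prop :=
  ∃ (w : ℂ) (s : Q → PauliLetter), w ≠ 0 ∧ A = w • pauliString s

theorem isPauli_one {Q : Type} [Fintype Q] [DecidableEq Q] : IsPauli (1 : Operator Q) :=
  ⟨1, fun _ => .I, one_ne_zero, by
    rw [pauliString_eq_tensor, one_smul, PauliLetter.toMatrix_I, tensor_one]⟩

theorem IsPauli.smul {Q : Type} [Fintype Q] {A : Operator Q} (hA : IsPauli A) {c : ℂ}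
    (hc : c ≠ 0) : IsPauli (c • A) := by
  obtain ⟨w, s, hw, rfl⟩ := hA
  exact ⟨c * w, s, mul_ne_zero hc hw, smul_smul _ _ _⟩

theorem IsPauli.mul {Q : Type} [Fintype Q] [DecidableEq Q] {A B : Operator Q} (hA : IsPauli A)
    (hB : IsPauli B) : IsPauli (A * B) := by
  obtain ⟨w, s, hw, rfl⟩ := hA
  obtain ⟨v, t, hv, rfl⟩ := hB
  choose c u hc hu using fun q => PauliLetter.exists_mul (s q) (t q)
  refine ⟨w * v * ∏ q, c q, u, mul_ne_zero (mul_ne_zero hw hv)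
    (Finset.prod_ne_zero_iff.mpr fun q _ => hc q), ?_⟩
  simp only [pauliString_eq_tensor, smul_mul_smul_comm, tensor_mul, hu, tensor_smul, smul_smul]

theorem IsPauli.list_prod {Q : Type} [Fintype Q] [DecidableEq Q] {l : List (Operator Q)}
    (hl : ∀ A ∈ l, IsPauli A) : IsPauli l.prod := by
  induction l with
  | nil => exact isPauli_one
  | cons A l ih =>
    rw [List.prod_cons]
    exact (hl A (by simp)).mul (ih fun B hB => hl B (by simp [hB]))

/-! ### The Jordan–Wigner form of the fermionic operators -/

/-- The Jordan–Wigner string `Z ⊗ ⋯ ⊗ Z ⊗ B ⊗ 1 ⊗ ⋯ ⊗ 1` with `B` at site `j`. -/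
def jordanWigner {N : ℕ} (j : Fin N) (B : Matrix Bool Bool ℂ) : Operator (Fin N) :=
  tensor (Function.update (fun q => if q < j then PauliLetter.Z.toMatrix else 1) j B)

/-- The annihilation operator `|0⟩⟨1|` of a single mode. -/
def lowering : Matrix Bool Bool ℂ :=
  Matrix.of fun x y => if x = false ∧ y = true then 1 else 0

theorem annihilation_eq_jordanWigner {N : ℕ} (j : Fin N) :
    annihilation j = jordanWigner j lowering := by
  ext x y
  simp only [annihilation, jordanWigner, tensor_apply, Matrix.of_apply]
  split_ifs with h
  · obtain ⟨hy, rfl⟩ := h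
    have : ∀ q, (Function.update (fun q => if q < j then PauliLetter.Z.toMatrix else 1) j lowering
        q) (Function.update y j false q) (y q) = if q < j ∧ y q = true then (-1 : ℂ) else 1 := by
      intro q
      by_cases hq : q = j
      · subst hq; simp [lowering, hy]
      · by_cases hl : q < j <;> simp [hq, hl, PauliLetter.toMatrix]
    rw [Finset.prod_congr rfl fun q _ => this q, Finset.prod_ite]
    simp
  · symm
    by_cases hj : y j = true ∧ x j = false
    · have : x ≠ Function.update y j false := fun hx => h ⟨hj.1, hx⟩
      obtain ⟨q, hq⟩ := Function.ne_iff.mp this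
      apply Finset.prod_eq_zero (Finset.mem_univ q)
      have hqj : q ≠ j := by
        rintro rfl
        simp [hj.2] at hq
      rw [Function.update_of_ne hqj] at hq ⊢
      by_cases hl : q < j
      · simp [hl, PauliLetter.toMatrix, hq]
      · simp [hl, hq]
    · apply Finset.prod_eq_zero (Finset.mem_univ j)
      rw [Function.update_self]
      simp only [lowering, Matrix.of_apply, ite_eq_right_iff]
      tauto

theorem jordanWigner_conjTranspose {N : ℕ} (j : Fin N) (B : Matrix Bool Bool ℂ) :
    (jordanWigner j B)ᴴ = jordanWigner j Bᴴ := by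
  rw [jordanWigner, jordanWigner, tensor_conjTranspose]
  congr 1
  funext q
  by_cases hq : q = j
  · subst hq; simp
  · by_cases hl : q < j <;> simp [hq, hl, PauliLetter.conjTranspose]

theorem creation_eq_jordanWigner {N : ℕ} (j : Fin N) :
    creation j = jordanWigner j loweringᴴ := by
  rw [creation, annihilation_eq_jordanWigner, jordanWigner_conjTranspose]

/-- The mode to which a Majorana operator belongs. -/
def mode {N : ℕ} (i : Fin (2 * N)) : Fin N := ⟨i.val / 2, by have := i.isLt; omega⟩

/-- The Pauli letter, `X` or `Y`, at the end of the Jordan–Wigner string of a Majorana operator. -/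
def majoranaLetter {N : ℕ} (i : Fin (2 * N)) : PauliLetter := if i.val % 2 = 0 then .X else .Y

theorem majorana_eq_jordanWigner {N : ℕ} (i : Fin (2 * N)) :
    majorana i = jordanWigner (mode i) (majoranaLetter i).toMatrix := by
  have hm : ∀ h, (⟨i.val / 2, h⟩ : Fin N) = mode i := fun _ => rfl
  simp only [majorana, hm, majoranaLetter, annihilation_eq_jordanWigner, creation_eq_jordanWigner]
  simp only [jordanWigner]
  split_ifs with h
  · rw [← tensor_update_add]
    congr 2
    ext x y
    cases x <;> cases y <;> simp [lowering, PauliLetter.toMatrix]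
  · rw [sub_eq_add_neg, ← neg_one_smul ℂ, ← tensor_update_smul, ← tensor_update_add,
      ← tensor_update_smul]
    congr 2
    ext x y
    cases x <;> cases y <;> simp [lowering, PauliLetter.toMatrix]

theorem jordanWigner_mul {N : ℕ} (j : Fin N) (B C : Matrix Bool Bool ℂ) :
    jordanWigner j B * jordanWigner j C = tensor (Function.update (fun _ => 1) j (B * C)) := by
  rw [jordanWigner, jordanWigner, tensor_mul]
  congr 1
  funext q
  by_cases hq : q = j
  · subst hq; simp
  · by_cases hl : q < j <;> simp [hq, hl, PauliLetter.mul_self]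

theorem jordanWigner_anticomm_of_lt {N : ℕ} {i j : Fin N} (hij : i < j) {B : Matrix Bool Bool ℂ}
    (hB : B * PauliLetter.Z.toMatrix = -(PauliLetter.Z.toMatrix * B)) (C : Matrix Bool Bool ℂ) :
    jordanWigner i B * jordanWigner j C = -(jordanWigner j C * jordanWigner i B) := by
  apply tensor_anticomm i
  · simp [hij.ne, hij, hB]
  · intro q hq
    by_cases hqj : q = j
    · subst hqj; simp [hij.ne', hij.not_gt]
    · by_cases h1 : q < i <;> by_cases h2 : q < j <;> simp [hq, hqj, h1, h2]

/-- Fermionic operators of different modes anticommute. -/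
theorem jordanWigner_anticomm {N : ℕ} {i j : Fin N} (hij : i ≠ j) {B C : Matrix Bool Bool ℂ}
    (hB : B * PauliLetter.Z.toMatrix = -(PauliLetter.Z.toMatrix * B))
    (hC : C * PauliLetter.Z.toMatrix = -(PauliLetter.Z.toMatrix * C)) :
    jordanWigner i B * jordanWigner j C = -(jordanWigner j C * jordanWigner i B) := by
  rcases lt_or_gt_of_ne hij with h | h
  · exact jordanWigner_anticomm_of_lt h hB C
  · rw [jordanWigner_anticomm_of_lt h hC B, neg_neg]

theorem majoranaLetter_anticomm {N : ℕ} (i : Fin (2 * N)) :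
    (majoranaLetter i).toMatrix * PauliLetter.Z.toMatrix =
      -(PauliLetter.Z.toMatrix * (majoranaLetter i).toMatrix) := by
  unfold majoranaLetter
  split_ifs <;> ext x y <;> cases x <;> cases y <;> simp [PauliLetter.toMatrix, Matrix.mul_apply]

theorem lowering_anticomm :
    lowering * PauliLetter.Z.toMatrix = -(PauliLetter.Z.toMatrix * lowering) := by
  ext x y; cases x <;> cases y <;> simp [lowering, PauliLetter.toMatrix, Matrix.mul_apply]

theorem lowering_conjTranspose_anticomm :
    loweringᴴ * PauliLetter.Z.toMatrix = -(PauliLetter.Z.toMatrix * loweringᴴ) := by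
  ext x y; cases x <;> cases y <;> simp [lowering, PauliLetter.toMatrix, Matrix.mul_apply]

theorem majorana_mul_self {N : ℕ} (i : Fin (2 * N)) : majorana i * majorana i = 1 := by
  rw [majorana_eq_jordanWigner, jordanWigner_mul, PauliLetter.mul_self, Function.update_eq_self,
    tensor_one]

theorem majorana_conjTranspose {N : ℕ} (i : Fin (2 * N)) : (majorana i)ᴴ = majorana i := by
  rw [majorana_eq_jordanWigner, jordanWigner_conjTranspose, PauliLetter.conjTranspose]

theorem majorana_anticomm {N : ℕ} {i j : Fin (2 * N)} (hij : i ≠ j) :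
    majorana i * majorana j = -(majorana j * majorana i) := by
  rw [majorana_eq_jordanWigner, majorana_eq_jordanWigner]
  by_cases h : mode i = mode j
  · rw [h]
    apply tensor_anticomm (mode j)
    · have : i.val / 2 = j.val / 2 := congrArg Fin.val h
      have hv : i.val ≠ j.val := fun h => hij (Fin.ext h)
      simp only [Function.update_self, majoranaLetter]
      rcases Nat.mod_two_eq_zero_or_one i.val with h1 | h1 <;>
        rcases Nat.mod_two_eq_zero_or_one j.val with h2 | h2
      · omega
      · ext x y; cases x <;> cases y <;> simp [h1, h2, PauliLetter.toMatrix, Matrix.mul_apply]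
      · ext x y; cases x <;> cases y <;> simp [h1, h2, PauliLetter.toMatrix, Matrix.mul_apply]
      · omega
    · intro q hq
      simp [hq]
  · exact jordanWigner_anticomm h (majoranaLetter_anticomm i) (majoranaLetter_anticomm j)

theorem isPauli_majorana {N : ℕ} (i : Fin (2 * N)) : IsPauli (majorana i) := by
  refine ⟨1, Function.update (fun q => if q < mode i then .Z else .I) (mode i) (majoranaLetter i),
    one_ne_zero, ?_⟩
  rw [one_smul, majorana_eq_jordanWigner, pauliString_eq_tensor, jordanWigner]
  congr 1
  funext q
  by_cases hq : q = mode i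
  · subst hq; simp
  · by_cases hl : q < mode i <;> simp [hq, hl, PauliLetter.toMatrix_I]

/-! ### Products of Majorana operators -/

/-- Equality up to a sign, the relation in which products of fermionic operators may be
reordered. -/
def EqUpToSign {R : Type} [Ring R] (a b : R) : Prop := a = b ∨ a = -b

namespace EqUpToSign

variable {R : Type} [Ring R] {a b c d : R}

theorem refl (a : R) : EqUpToSign a a := Or.inl rfl

theorem symm (h : EqUpToSign a b) : EqUpToSign b a := by
  rcases h with rfl | rfl
  · exact Or.inl rfl
  · exact Or.inr (neg_neg b).symm

theorem trans (h : EqUpToSign a b) (h' : EqUpToSign b c) : EqUpToSign a c := by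
  rcases h with rfl | rfl
  · exact h'
  · rcases h' with rfl | rfl
    · exact Or.inr rfl
    · exact Or.inl (neg_neg c)

theorem mul (h : EqUpToSign a b) (h' : EqUpToSign c d) : EqUpToSign (a * c) (b * d) := by
  rcases h with rfl | rfl <;> rcases h' with rfl | rfl
  · exact Or.inl rfl
  · exact Or.inr (mul_neg _ _)
  · exact Or.inr (neg_mul _ _)
  · exact Or.inl (neg_mul_neg _ _)

theorem mul_prod_comm {l : List R} (h : ∀ y ∈ l, EqUpToSign (a * y) (y * a)) :
    EqUpToSign (a * l.prod) (l.prod * a) := by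
  induction l with
  | nil => simpa using refl a
  | cons y l ih =>
    have h1 := (h y (by simp)).mul (refl l.prod)
    have h2 := (refl y).mul (ih fun z hz => h z (by simp [hz]))
    simp only [List.prod_cons, ← mul_assoc] at h1 h2 ⊢
    exact h1.trans h2

end EqUpToSign

section MajoranaProd

variable {N : ℕ}

theorem majorana_mul_comm (a b : Fin (2 * N)) :
    EqUpToSign (majorana a * majorana b) (majorana b * majorana a) := by
  by_cases h : a = b
  · subst h; exact EqUpToSign.refl _
  · exact Or.inr (majorana_anticomm h)

theorem majorana_prod_perm {l l' : List (Fin (2 * N))} (h : l.Perm l') :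
    EqUpToSign (l.map majorana).prod (l'.map majorana).prod := by
  induction h with
  | nil => exact EqUpToSign.refl _
  | cons a _ ih =>
    simp only [List.map_cons, List.prod_cons]
    exact (EqUpToSign.refl _).mul ih
  | swap a b l =>
    simp only [List.map_cons, List.prod_cons, ← mul_assoc]
    exact (majorana_mul_comm b a).mul (EqUpToSign.refl _)
  | trans _ _ ih1 ih2 => exact ih1.trans ih2

theorem majorana_mul_prod (a : Fin (2 * N)) (l : List (Fin (2 * N))) :
    majorana a * (l.map majorana).prod =
      (-1 : ℂ) ^ l.countP (· ≠ a) • ((l.map majorana).prod * majorana a) := by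
  induction l with
  | nil => simp
  | cons b l ih =>
    rw [List.map_cons, List.prod_cons, ← mul_assoc]
    by_cases h : b = a
    · subst h
      rw [List.countP_cons_of_neg (by simp), mul_assoc]
      nth_rewrite 1 [ih]
      rw [mul_smul_comm, mul_assoc]
    · rw [List.countP_cons_of_pos (by simpa using h), majorana_anticomm (Ne.symm h), neg_mul,
        mul_assoc, ih, mul_smul_comm, ← mul_assoc, pow_succ, mul_neg_one, neg_smul]

theorem majorana_prod_mul_prod (l l' : List (Fin (2 * N))) :
    (l.map majorana).prod * (l'.map majorana).prod =
      (l.map fun a => (-1 : ℂ) ^ l'.countP (· ≠ a)).prod •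
        ((l'.map majorana).prod * (l.map majorana).prod) := by
  induction l with
  | nil => simp
  | cons a l ih =>
    simp only [List.map_cons, List.prod_cons]
    rw [mul_assoc, ih, mul_smul_comm, ← mul_assoc, majorana_mul_prod, smul_mul_assoc, smul_smul,
      mul_assoc, mul_comm (List.prod _)]

theorem majorana_prod_mul_self {l : List (Fin (2 * N))} (hl : l.Nodup) :
    (l.map majorana).prod * (l.map majorana).prod = (-1 : ℂ) ^ l.length.choose 2 • 1 := by
  induction l with
  | nil => simp
  | cons a l ih =>
    rw [List.nodup_cons] at hl
    have hc : l.countP (· ≠ a) = l.length :=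
      List.countP_eq_length.mpr fun b hb => by
        simp only [ne_eq, decide_not, Bool.not_eq_eq_eq_not, Bool.not_true, decide_eq_false_iff_not]
        rintro rfl
        exact hl.1 hb
    have h1 : (l.map majorana).prod * majorana a =
        (-1 : ℂ) ^ l.length • (majorana a * (l.map majorana).prod) := by
      rw [majorana_mul_prod, hc, smul_smul, ← mul_pow]
      simp
    rw [List.map_cons, List.prod_cons, mul_assoc, ← mul_assoc _ (majorana a), h1, smul_mul_assoc,
      mul_smul_comm, mul_assoc (majorana a), ← mul_assoc (majorana a), majorana_mul_self, one_mul,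
      ih hl.2, smul_smul, List.length_cons, Nat.choose_succ_succ', Nat.choose_one_right, pow_add]

theorem majorana_prod_unitary (l : List (Fin (2 * N))) :
    ((l.map majorana).prod)ᴴ * (l.map majorana).prod = 1 := by
  induction l with
  | nil => simp
  | cons a l ih =>
    rw [List.map_cons, List.prod_cons, Matrix.conjTranspose_mul, majorana_conjTranspose, mul_assoc,
      ← mul_assoc (majorana a), majorana_mul_self, one_mul, ih]

end MajoranaProd

section MajoranaOp

variable {N k : ℕ}

theorem majoranaOp_eqUpToSign_smul (T : MajoranaIndex N k) {l : List (Fin (2 * N))}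
    (hl : l.Nodup) (h : l.toFinset = T.1) :
    ∃ w : ℂ, ‖w‖ = 1 ∧ majoranaOp T = w • (l.map majorana).prod := by
  have hp : (T.1.sort (· ≤ ·)).Perm l := by
    refine (List.perm_ext_iff_of_nodup (Finset.sort_nodup _ _) hl).mpr fun a => ?_
    rw [Finset.mem_sort, ← h, List.mem_toFinset]
  rcases majorana_prod_perm hp with h | h
  · exact ⟨Complex.I ^ k, by simp, by rw [majoranaOp, h]⟩
  · exact ⟨-Complex.I ^ k, by simp, by rw [majoranaOp, h, smul_neg, neg_smul]⟩

theorem majoranaOp_mul_self (T : MajoranaIndex N k) : majoranaOp T * majoranaOp T = 1 := by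
  have hk : (2 * k).choose 2 = k * (2 * k - 1) := by
    rw [Nat.choose_two_right, mul_assoc, Nat.mul_div_cancel_left _ two_pos]
  have hI : Complex.I ^ k * Complex.I ^ k = (-1) ^ k := by rw [← mul_pow, Complex.I_mul_I]
  rw [majoranaOp, smul_mul_smul_comm, majorana_prod_mul_self (Finset.sort_nodup _ _),
    Finset.length_sort, T.2, smul_smul, hI, hk, mul_comm k, pow_mul, ← mul_pow]
  rcases Nat.eq_zero_or_pos k with rfl | hk0
  · simp
  · rw [Odd.neg_one_pow ⟨k - 1, by omega⟩]
    simp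

theorem majoranaOp_conjTranspose (T : MajoranaIndex N k) : (majoranaOp T)ᴴ = majoranaOp T := by
  have h : (majoranaOp T)ᴴ * majoranaOp T = 1 := by
    rw [majoranaOp, Matrix.conjTranspose_smul, smul_mul_smul_comm, majorana_prod_unitary]
    simp [← mul_pow]
  calc (majoranaOp T)ᴴ = (majoranaOp T)ᴴ * (majoranaOp T * majoranaOp T) := by
        rw [majoranaOp_mul_self, mul_one]
    _ = majoranaOp T := by rw [← mul_assoc, h, one_mul]

theorem isPauli_majoranaOp (T : MajoranaIndex N k) : IsPauli (majoranaOp T) := by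
  refine IsPauli.smul (IsPauli.list_prod fun A hA => ?_) (pow_ne_zero _ Complex.I_ne_zero)
  obtain ⟨a, -, rfl⟩ := List.mem_map.mp hA
  exact isPauli_majorana a

theorem countP_ne_sort (T : Finset (Fin (2 * N))) (a : Fin (2 * N)) :
    (T.sort (· ≤ ·)).countP (· ≠ a) + (if a ∈ T then 1 else 0) = T.card := by
  have h1 := List.length_eq_countP_add_countP (fun b => decide (b ≠ a)) (l := T.sort (· ≤ ·))
  have h2 : (T.sort (· ≤ ·)).countP (fun b => decide ¬(decide (b ≠ a)) = true) =
      if a ∈ T then 1 else 0 := by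
    have := List.Nodup.count (a := a) (Finset.sort_nodup T (· ≤ ·))
    simp only [Finset.mem_sort] at this
    rw [← this, List.count]
    congr 1
    funext b
    by_cases h : b = a <;> simp [h]
  rw [Finset.length_sort] at h1
  omega

theorem neg_one_pow_countP_ne_sort {T : Finset (Fin (2 * N))} (hT : Even T.card)
    (a : Fin (2 * N)) :
    (-1 : ℂ) ^ (T.sort (· ≤ ·)).countP (· ≠ a) = if a ∈ T then -1 else 1 := by
  have h := countP_ne_sort T a
  split_ifs at h ⊢ with ha
  · refine Odd.neg_one_pow ?_
    rw [← h] at hT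
    exact (Nat.even_add_one.mp hT |> Nat.not_even_iff_odd.mp)
  · rw [add_zero] at h
    rw [h, hT.neg_one_pow]

theorem majoranaOp_mul_comm {k' : ℕ} (T : MajoranaIndex N k) (T' : MajoranaIndex N k') :
    majoranaOp T * majoranaOp T' =
      (-1 : ℂ) ^ (T.1 ∩ T'.1).card • (majoranaOp T' * majoranaOp T) := by
  have hs : ((T.1.sort (· ≤ ·)).map fun a =>
      (-1 : ℂ) ^ (T'.1.sort (· ≤ ·)).countP (· ≠ a)).prod = (-1) ^ (T.1 ∩ T'.1).card := by
    rw [← List.prod_toFinset _ (Finset.sort_nodup _ _), Finset.sort_toFinset,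
      Finset.prod_congr rfl fun a _ => neg_one_pow_countP_ne_sort (by rw [T'.2]; exact even_two_mul k') a,
      Finset.prod_ite_mem, Finset.prod_const]
  rw [majoranaOp, majoranaOp, smul_mul_smul_comm, smul_mul_smul_comm, majorana_prod_mul_prod, hs,
    smul_smul, smul_smul]
  congr 1
  ring

/-- Commuting Majorana operators of even degree overlap in an even number of indices. -/
theorem even_inter_of_commute {T T' : MajoranaIndex N k}
    (h : Commute (majoranaOp T) (majoranaOp T')) : Even (T.1 ∩ T'.1).card := by
  by_contra hodd
  have h1 := majoranaOp_mul_comm T T'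
  rw [(Nat.not_even_iff_odd.mp hodd).neg_one_pow, h.eq, neg_one_smul, eq_neg_iff_add_eq_zero,
    ← two_smul ℂ, smul_eq_zero_iff_right two_ne_zero] at h1
  have h2 : majoranaOp T' * (majoranaOp T' * majoranaOp T) * majoranaOp T = 1 := by
    rw [← mul_assoc, majoranaOp_mul_self, one_mul, majoranaOp_mul_self]
  rw [h1, mul_zero, zero_mul] at h2
  exact zero_ne_one h2

theorem trace_majoranaOp (hk : 1 ≤ k) (T : MajoranaIndex N k) : (majoranaOp T).trace = 0 := by
  have hne : T.1.Nonempty := Finset.card_pos.mp (by rw [T.2]; omega)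
  obtain ⟨a, ha⟩ := hne
  have h1 : majorana a * majoranaOp T = -(majoranaOp T * majorana a) := by
    rw [majoranaOp, mul_smul_comm, majorana_mul_prod,
      neg_one_pow_countP_ne_sort (by rw [T.2]; exact even_two_mul k), if_pos ha, neg_one_smul, smul_neg,
      smul_mul_assoc]
  have h2 : (majorana a * (majorana a * majoranaOp T)).trace = (majoranaOp T).trace := by
    rw [← mul_assoc, majorana_mul_self, one_mul]
  have h3 : (majorana a * (majorana a * majoranaOp T)).trace = -(majoranaOp T).trace := by
    rw [h1, mul_neg, Matrix.trace_neg, Matrix.trace_mul_comm, mul_assoc, majorana_mul_self,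
      mul_one]
  exact self_eq_neg.mp (h2.symm.trans h3)

end MajoranaOp

/-! ### Fermion parity -/

theorem tensor_Z_eq_diagonal {N : ℕ} : (tensor fun _ : Fin N => PauliLetter.Z.toMatrix) =
    Matrix.diagonal fun x => (fermionParity x : ℂ) := by
  ext x y
  rw [tensor_apply, Matrix.diagonal_apply]
  split_ifs with h
  · subst h
    simp only [PauliLetter.toMatrix, Matrix.of_apply, if_true, fermionParity, Finset.prod_ite]
    simp
  · obtain ⟨q, hq⟩ := Function.ne_iff.mp h
    exact Finset.prod_eq_zero (Finset.mem_univ q) (by simp [PauliLetter.toMatrix, hq])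

theorem majorana_mul_tensor_Z {N : ℕ} (a : Fin (2 * N)) :
    majorana a * (tensor fun _ => PauliLetter.Z.toMatrix) =
      -((tensor fun _ => PauliLetter.Z.toMatrix) * majorana a) := by
  rw [majorana_eq_jordanWigner]
  apply tensor_anticomm (mode a)
  · simp [majoranaLetter_anticomm]
  · intro q hq
    by_cases hl : q < mode a <;> simp [hq, hl]

theorem majorana_prod_mul_tensor_Z {N : ℕ} (l : List (Fin (2 * N))) :
    (l.map majorana).prod * (tensor fun _ => PauliLetter.Z.toMatrix) =
      (-1 : ℂ) ^ l.length • ((tensor fun _ => PauliLetter.Z.toMatrix) * (l.map majorana).prod) := by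
  induction l with
  | nil => simp
  | cons a l ih =>
    rw [List.map_cons, List.prod_cons, mul_assoc, ih, mul_smul_comm, ← mul_assoc,
      majorana_mul_tensor_Z, List.length_cons, pow_succ, mul_neg_one, neg_smul, neg_mul, smul_neg,
      mul_assoc]

theorem majoranaOp_even {N k : ℕ} (T : MajoranaIndex N k) {x y : Fin N → Bool}
    (h : fermionParity x ≠ fermionParity y) : majoranaOp T x y = 0 := by
  have h1 := majorana_prod_mul_tensor_Z (T.1.sort (· ≤ ·))
  rw [Finset.length_sort, T.2, (even_two_mul k).neg_one_pow, one_smul, tensor_Z_eq_diagonal] at h1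
  have h2 := congrFun (congrFun h1 x) y
  rw [Matrix.mul_diagonal, Matrix.diagonal_mul, mul_comm, ← sub_eq_zero, ← sub_mul, mul_eq_zero]
    at h2
  rw [majoranaOp, Matrix.smul_apply]
  rcases h2 with h2 | h2
  · exact absurd (Int.cast_injective (sub_eq_zero.mp h2)).symm h
  · rw [h2, smul_zero]

/-! ### Clifford circuits with ancillas -/

theorem pauliString_conjTranspose {Q : Type} [Fintype Q] (s : Q → PauliLetter) :
    (pauliString s)ᴴ = pauliString s := by
  rw [pauliString_eq_tensor, tensor_conjTranspose]
  simp only [PauliLetter.conjTranspose]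

/-- The product of the Pauli `Z` matrices on the qubits in `S`, whose value is a parity of the
readout. -/
def parityString {Q : Type} [Fintype Q] [DecidableEq Q] (S : Finset Q) : Operator Q :=
  pauliString fun q => if q ∈ S then PauliLetter.Z else PauliLetter.I

theorem parityString_commute {Q : Type} [Fintype Q] [DecidableEq Q] (S S' : Finset Q) :
    parityString S * parityString S' = parityString S' * parityString S := by
  simp only [parityString, pauliString_eq_tensor, tensor_mul]
  congr 1
  funext q
  split_ifs <;> simp [PauliLetter.toMatrix_I]

/-- A Pauli string with a nonzero diagonal entry contains only the letters `I` and `Z`. -/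
theorem exists_eq_parityString {Q : Type} [Fintype Q] [DecidableEq Q] {s : Q → PauliLetter}
    {z : Q → Bool} (h : pauliString s z z ≠ 0) : ∃ S, pauliString s = parityString S := by
  classical
  refine ⟨Finset.univ.filter fun q => s q = .Z, ?_⟩
  rw [parityString]
  congr 1
  funext q
  have hq : (s q).toMatrix (z q) (z q) ≠ 0 :=
    Finset.prod_ne_zero_iff.mp h q (Finset.mem_univ q)
  cases hs : s q <;> simp [hs, PauliLetter.toMatrix] at hq ⊢

/-- The isometry `|y⟩ ↦ |y⟩ ⊗ |0⟩` that adds `a` ancilla qubits. -/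
noncomputable def ancillaIsometry (N a : ℕ) : Matrix (Outcome N a) (Fin N → Bool) ℂ :=
  Matrix.of fun x y => if x = Sum.elim y (fun _ => false) then 1 else 0

theorem ancillaIsometry_compress {N a : ℕ} (A : Operator (Fin N ⊕ Fin a)) :
    (ancillaIsometry N a)ᴴ * A * ancillaIsometry N a =
      Matrix.of fun x y => A (Sum.elim x fun _ => false) (Sum.elim y fun _ => false) := by
  ext x y
  simp [Matrix.mul_apply, ancillaIsometry, Matrix.conjTranspose_apply]

theorem ancillaIsometry_isometry (N a : ℕ) :
    (ancillaIsometry N a)ᴴ * ancillaIsometry N a = 1 := by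
  have h := ancillaIsometry_compress (N := N) (a := a) 1
  rw [Matrix.mul_one] at h
  rw [h]
  ext x y
  by_cases hxy : x = y
  · subst hxy; simp
  · have : Sum.elim x (fun _ : Fin a => false) ≠ Sum.elim y (fun _ : Fin a => false) := fun h' =>
      hxy (funext fun i => congrFun h' (Sum.inl i))
    simp [Matrix.one_apply, hxy, this]

theorem withAncillas_eq {N a : ℕ} (ρ : Operator (Fin N)) :
    withAncillas a ρ = ancillaIsometry N a * ρ * (ancillaIsometry N a)ᴴ := by
  ext x y
  have key : ∀ (x : Outcome N a) (v : Fin N → Bool), x = Sum.elim v (fun _ => false) ↔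
      (∀ i, x (Sum.inr i) = false) ∧ v = fun i => x (Sum.inl i) := by
    intro x v
    constructor
    · rintro rfl
      exact ⟨fun i => rfl, rfl⟩
    · rintro ⟨h, rfl⟩
      funext q
      rcases q with q | q
      · rfl
      · exact h q
  simp only [withAncillas, Matrix.of_apply, Matrix.mul_apply, ancillaIsometry,
    Matrix.conjTranspose_apply, key, forall_and]
  by_cases hx : ∀ i : Fin a, x (Sum.inr i) = false
  · by_cases hy : ∀ i : Fin a, y (Sum.inr i) = false
    · simp [hx, hy]
    · simp [hy]
  · simp [hx]

namespace CliffordCircuit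

variable {N a : ℕ} (U : CliffordCircuit N a)

theorem mul_conjTranspose_self : U.1 * U.1ᴴ = 1 := Matrix.mem_unitaryGroup_iff.mp U.2.1

theorem conjTranspose_mul_self : U.1ᴴ * U.1 = 1 := Matrix.mem_unitaryGroup_iff'.mp U.2.1

theorem readout_eq (S : Finset (Fin N ⊕ Fin a)) :
    U.readout S =
      (ancillaIsometry N a)ᴴ * (U.1ᴴ * parityString S * U.1) * ancillaIsometry N a := by
  rw [ancillaIsometry_compress]
  rfl

theorem parity_unitary (S : Finset (Fin N ⊕ Fin a)) :
    (U.1ᴴ * parityString S * U.1)ᴴ * (U.1ᴴ * parityString S * U.1) = 1 := by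
  simp only [Matrix.conjTranspose_mul, Matrix.conjTranspose_conjTranspose, parityString,
    pauliString_conjTranspose]
  rw [show ∀ A : Operator (Fin N ⊕ Fin a), U.1ᴴ * (A * U.1) * (U.1ᴴ * A * U.1) =
    U.1ᴴ * (A * (U.1 * U.1ᴴ) * A) * U.1 from fun A => by simp only [mul_assoc],
    mul_conjTranspose_self, mul_one, pauliString_mul_self, mul_one, conjTranspose_mul_self]

theorem parity_commute (S S' : Finset (Fin N ⊕ Fin a)) :
    (U.1ᴴ * parityString S * U.1) * (U.1ᴴ * parityString S' * U.1) =
      (U.1ᴴ * parityString S' * U.1) * (U.1ᴴ * parityString S * U.1) := by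
  have h : ∀ A B : Operator (Fin N ⊕ Fin a), (U.1ᴴ * A * U.1) * (U.1ᴴ * B * U.1) =
      U.1ᴴ * (A * B) * U.1 := fun A B => by
    calc _ = U.1ᴴ * A * (U.1 * U.1ᴴ) * B * U.1 := by simp only [mul_assoc]
      _ = _ := by rw [mul_conjTranspose_self, mul_one, mul_assoc U.1ᴴ]
  rw [h, h, parityString_commute]

/-- If the compression of a unitary `P` by an isometry `V` is unitary, then `P` leaves the range of
`V` invariant. -/
theorem mul_eq_of_compression_unitary {m n : Type} [Fintype m] [Fintype n] [DecidableEq m]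
    [DecidableEq n] {V : Matrix m n ℂ} {P : Matrix m m ℂ} {R : Matrix n n ℂ} (hV : Vᴴ * V = 1)
    (hP : Pᴴ * P = 1) (hR : Vᴴ * P * V = R) (hRu : Rᴴ * R = 1) : P * V = V * R := by
  have hR' : Vᴴ * Pᴴ * V = Rᴴ := by
    rw [← hR]
    simp only [Matrix.conjTranspose_mul, Matrix.conjTranspose_conjTranspose, Matrix.mul_assoc]
  have h : (P * V - V * R)ᴴ * (P * V - V * R) = 0 := by
    calc (P * V - V * R)ᴴ * (P * V - V * R)
        = Vᴴ * (Pᴴ * P) * V - (Vᴴ * Pᴴ * V) * R - Rᴴ * (Vᴴ * P * V) + Rᴴ * (Vᴴ * V) * R := by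
          simp only [Matrix.conjTranspose_sub, Matrix.conjTranspose_mul, Matrix.sub_mul,
            Matrix.mul_sub, Matrix.mul_assoc]
          abel
      _ = 0 := by
          rw [hP, hR', hR, hV, Matrix.mul_one, Matrix.mul_one, hV, hRu]
          abel
  exact sub_eq_zero.mp (Matrix.conjTranspose_mul_self_eq_zero.mp h)

/-- The Majorana operators measured by one circuit commute: the corresponding readout parities are
unitary on the whole register, commute there, and leave the code space `|0⟩` of the ancillas
invariant. -/
theorem clique_pairwise_commute (k : ℕ) : (U.clique k).Pairwise Commute := by
  rintro G ⟨⟨T, rfl⟩, S, hS⟩ G' ⟨⟨T', rfl⟩, S', hS'⟩ -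
  have inv : ∀ (T : MajoranaIndex N k) (S : Finset (Fin N ⊕ Fin a)),
      (U.readout S = majoranaOp T ∨ U.readout S = -majoranaOp T) →
        (U.1ᴴ * parityString S * U.1) * ancillaIsometry N a =
          ancillaIsometry N a * U.readout S := by
    intro T S h
    refine mul_eq_of_compression_unitary (ancillaIsometry_isometry N a) (U.parity_unitary S)
      (U.readout_eq S).symm ?_
    rcases h with h | h <;>
      simp [h, majoranaOp_conjTranspose, majoranaOp_mul_self]
  have prod : ∀ (T T' : MajoranaIndex N k) (S S' : Finset (Fin N ⊕ Fin a)),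
      (U.readout S = majoranaOp T ∨ U.readout S = -majoranaOp T) →
      (U.readout S' = majoranaOp T' ∨ U.readout S' = -majoranaOp T') →
        U.readout S * U.readout S' = (ancillaIsometry N a)ᴴ *
          ((U.1ᴴ * parityString S * U.1) * (U.1ᴴ * parityString S' * U.1)) *
            ancillaIsometry N a := by
    intro T T' S S' h h'
    rw [Matrix.mul_assoc, Matrix.mul_assoc _ _ (ancillaIsometry N a), inv T' S' h',
      ← Matrix.mul_assoc _ (ancillaIsometry N a), inv T S h, ← Matrix.mul_assoc,
      ← Matrix.mul_assoc, ancillaIsometry_isometry, Matrix.one_mul]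
  have hcomm : U.readout S * U.readout S' = U.readout S' * U.readout S := by
    rw [prod T T' S S' hS hS', prod T' T S' S hS' hS, parity_commute]
  rw [commute_iff_eq]
  rcases hS with h | h <;> rcases hS' with h' | h' <;> simpa [h, h'] using hcomm

end CliffordCircuit

/-! ### Readout probabilities -/

theorem withAncillas_add {N a : ℕ} (ρ σ : Operator (Fin N)) :
    withAncillas a (ρ + σ) = withAncillas a ρ + withAncillas a σ := by
  simp only [withAncillas_eq, Matrix.mul_add, Matrix.add_mul]

theorem withAncillas_smul {N a : ℕ} (c : ℂ) (ρ : Operator (Fin N)) :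
    withAncillas a (c • ρ) = c • withAncillas a ρ := by
  simp only [withAncillas_eq, Matrix.mul_smul, Matrix.smul_mul]

/-- `P ⊗ |0⟩⟨0|` is the average of the Pauli strings that extend `P` by letters `I` and `Z` on the
ancillas. -/
theorem withAncillas_pauliString {N a : ℕ} (s : Fin N → PauliLetter) :
    withAncillas a (pauliString s) = ((2 : ℂ) ^ a)⁻¹ • ∑ f : Fin a → Bool,
      pauliString (Sum.elim s fun i => if f i then PauliLetter.Z else PauliLetter.I) := by
  ext x y
  have h2 : ∀ u v : Bool, ∑ b : Bool, (if b then PauliLetter.Z else PauliLetter.I).toMatrix u v =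
      if u = false ∧ v = false then (2 : ℂ) else 0 := by
    intro u v
    cases u <;> cases v <;> norm_num [PauliLetter.toMatrix]
  have h1 : ∑ f : Fin a → Bool, ∏ i, (if f i then PauliLetter.Z else PauliLetter.I).toMatrix
      (x (Sum.inr i)) (y (Sum.inr i)) =
      if ∀ i : Fin a, x (Sum.inr i) = false ∧ y (Sum.inr i) = false then (2 : ℂ) ^ a else 0 := by
    have h := Finset.prod_univ_sum (fun _ : Fin a => (Finset.univ : Finset Bool)) fun i b =>
      (if b then PauliLetter.Z else PauliLetter.I).toMatrix (x (Sum.inr i)) (y (Sum.inr i))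
    rw [Fintype.piFinset_univ] at h
    refine h.symm.trans ?_
    rw [Finset.prod_congr rfl fun i _ => h2 _ _, Finset.prod_ite_zero]
    simp
  simp only [withAncillas, Matrix.of_apply, Matrix.smul_apply, Matrix.sum_apply, pauliString,
    Fintype.prod_sum_type, Sum.elim_inl, Sum.elim_inr, ← Finset.mul_sum, h1, smul_eq_mul]
  split_ifs
  · field_simp
  · simp

namespace CliffordCircuit

variable {N a : ℕ} (U : CliffordCircuit N a)

theorem prob_add (ρ σ : Operator (Fin N)) (z : Outcome N a) :
    U.prob (ρ + σ) z = U.prob ρ z + U.prob σ z := by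
  simp [prob, withAncillas_add, mul_add, add_mul]

theorem prob_smul (c : ℝ) (ρ : Operator (Fin N)) (z : Outcome N a) :
    U.prob ((c : ℂ) • ρ) z = c * U.prob ρ z := by
  rw [prob, prob, withAncillas_smul, Matrix.mul_smul, Matrix.smul_mul, Matrix.smul_apply]
  simp

theorem prob_nonneg {ρ : Operator (Fin N)} (hρ : ρ.PosSemidef) (z : Outcome N a) :
    0 ≤ U.prob ρ z := by
  have h1 : (withAncillas a ρ).PosSemidef := by
    rw [withAncillas_eq]
    exact hρ.mul_mul_conjTranspose_same _
  exact (Complex.nonneg_iff.mp (h1.mul_mul_conjTranspose_same U.1).diag_nonneg).1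

theorem sum_prob (ρ : Operator (Fin N)) : ∑ z, U.prob ρ z = ρ.trace.re := by
  have h : (U.1 * withAncillas a ρ * U.1ᴴ).trace = ρ.trace := by
    rw [Matrix.trace_mul_comm, ← mul_assoc, conjTranspose_mul_self, one_mul, withAncillas_eq,
      Matrix.trace_mul_comm, ← Matrix.mul_assoc, ancillaIsometry_isometry, Matrix.one_mul]
  rw [← h, Matrix.trace, Complex.re_sum]
  rfl

/-- A Majorana operator outside the clique of a circuit does not contribute to the readout
statistics of this circuit. -/
theorem prob_majoranaOp_eq_zero {k : ℕ} {T : MajoranaIndex N k} (hT : majoranaOp T ∉ U.clique k)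
    (z : Outcome N a) : U.prob (majoranaOp T) z = 0 := by
  obtain ⟨w, s, hw, hs⟩ := isPauli_majoranaOp T
  have hw2 : w = 1 ∨ w = -1 := by
    have h := majoranaOp_mul_self T
    rw [hs, smul_mul_smul_comm, pauliString_mul_self] at h
    have h' := congrFun (congrFun h fun _ => false) fun _ => false
    rw [Matrix.smul_apply, Matrix.one_apply_eq, smul_eq_mul, mul_one] at h'
    exact mul_self_eq_one_iff.mp h'
  suffices h : ∀ f : Fin a → Bool, (U.1 * pauliString (Sum.elim s fun i =>
      if f i then PauliLetter.Z else PauliLetter.I) * U.1ᴴ) z z = 0 by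
    rw [prob, hs, withAncillas_smul, withAncillas_pauliString]
    simp only [Matrix.mul_smul, Matrix.smul_mul, Matrix.mul_sum, Matrix.sum_mul, Matrix.smul_apply,
      Matrix.sum_apply, h]
    simp
  intro f
  set P := pauliString (Sum.elim s fun i => if f i then PauliLetter.Z else PauliLetter.I) with hP
  by_contra hne
  obtain ⟨j, s', hj⟩ := U.2.2 (Sum.elim s fun i => if f i then PauliLetter.Z else PauliLetter.I)
  rw [← hP] at hj
  obtain ⟨S, hS⟩ : ∃ S, pauliString s' = parityString S := by
    apply exists_eq_parityString (z := z)
    intro h0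
    rw [hj, Matrix.smul_apply, h0, smul_zero] at hne
    exact hne rfl
  rw [hS] at hj
  -- Both sides square to the identity, which leaves only the phases `1` and `-1`.
  have hphase : Complex.I ^ j = 1 ∨ Complex.I ^ j = -1 := by
    have h1 : (U.1 * P * U.1ᴴ) * (U.1 * P * U.1ᴴ) = 1 := by
      calc _ = U.1 * P * (U.1ᴴ * U.1) * P * U.1ᴴ := by simp only [mul_assoc]
        _ = 1 := by
          rw [conjTranspose_mul_self, mul_one, mul_assoc U.1, pauliString_mul_self, mul_one,
            mul_conjTranspose_self]
    rw [hj, smul_mul_smul_comm, parityString, pauliString_mul_self] at h1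
    have h' := congrFun (congrFun h1 z) z
    rw [Matrix.smul_apply, Matrix.one_apply_eq, smul_eq_mul, mul_one] at h'
    exact mul_self_eq_one_iff.mp h'
  have hback : P = Complex.I ^ j • (U.1ᴴ * parityString S * U.1) := by
    rw [← Matrix.smul_mul, ← Matrix.mul_smul, ← hj]
    calc P = (U.1ᴴ * U.1) * P * (U.1ᴴ * U.1) := by
          rw [conjTranspose_mul_self, one_mul, mul_one]
      _ = _ := by simp only [mul_assoc]
  have hcomp : (ancillaIsometry N a)ᴴ * P * ancillaIsometry N a = pauliString s := by
    rw [ancillaIsometry_compress, hP]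
    ext x y
    simp only [Matrix.of_apply, pauliString, Fintype.prod_sum_type, Sum.elim_inl, Sum.elim_inr]
    have hone : ∏ i : Fin a, (if f i then PauliLetter.Z else PauliLetter.I).toMatrix false false =
        1 := Finset.prod_eq_one fun i _ => by split_ifs <;> simp [PauliLetter.toMatrix]
    exact (congrArg _ hone).trans (mul_one _)
  rw [hback, Matrix.mul_smul, Matrix.smul_mul, ← readout_eq] at hcomp
  refine hT ⟨⟨T, rfl⟩, S, ?_⟩
  rw [hs, ← hcomp]
  rcases hw2 with rfl | rfl <;> rcases hphase with h | h <;> simp [h]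

end CliffordCircuit

/-! ### The test states -/

/-- The state `(1 + δ G_T) / 2 ^ N`, in which `G_T` is the only Majorana operator, apart from the
identity, whose expectation value does not vanish. -/
noncomputable def majoranaState {N k : ℕ} (T : MajoranaIndex N k) (δ : ℝ) : Operator (Fin N) :=
  (((2 : ℝ) ^ N)⁻¹ : ℝ) • (1 + (δ : ℂ) • majoranaOp T)

section MajoranaState

variable {N k : ℕ}

theorem majoranaState_eq (T : MajoranaIndex N k) (δ : ℝ) :
    majoranaState T δ =
      ((((2 : ℝ) ^ N)⁻¹ : ℝ) : ℂ) • 1 +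
        ((δ * ((2 : ℝ) ^ N)⁻¹ : ℝ) : ℂ) • majoranaOp T := by
  rw [majoranaState, smul_add]
  congr 1
  rw [← Complex.coe_smul, smul_smul]
  push_cast
  rw [mul_comm]

theorem posSemidef_one_add_majoranaOp (T : MajoranaIndex N k) {c : ℂ} (hc : c = 1 ∨ c = -1) :
    (1 + c • majoranaOp T).PosSemidef := by
  have h : (1 + c • majoranaOp T)ᴴ * (1 + c • majoranaOp T) = (2 : ℝ) • (1 + c • majoranaOp T) := by
    rw [Matrix.conjTranspose_add, Matrix.conjTranspose_one, Matrix.conjTranspose_smul,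
      majoranaOp_conjTranspose, two_smul]
    have hcc : star c = c ∧ c * c = 1 := by rcases hc with rfl | rfl <;> simp
    rw [hcc.1, add_mul, mul_add, mul_add, smul_mul_smul_comm, majoranaOp_mul_self, hcc.2]
    simp only [one_mul, mul_one, one_smul]
    abel
  have h2 : 1 + c • majoranaOp T =
      (2⁻¹ : ℝ) • ((1 + c • majoranaOp T)ᴴ * (1 + c • majoranaOp T)) := by
    rw [h, smul_smul]; norm_num
  rw [h2]
  exact (Matrix.posSemidef_conjTranspose_mul_self _).smul (by norm_num)

theorem isFermionState_majoranaState (hk : 1 ≤ k) (T : MajoranaIndex N k) {δ : ℝ} (hδ : |δ| ≤ 1) :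
    IsFermionState (majoranaState T δ) where
  posSemidef := by
    obtain ⟨h1, h2⟩ := abs_le.mp hδ
    have h : 1 + (δ : ℂ) • majoranaOp T = ((1 + δ) / 2) • (1 + (1 : ℂ) • majoranaOp T) +
        ((1 - δ) / 2) • (1 + (-1 : ℂ) • majoranaOp T) := by
      ext x y
      simp only [Matrix.add_apply, Matrix.smul_apply, smul_eq_mul, Complex.real_smul]
      push_cast
      ring
    rw [majoranaState, h]
    exact (((posSemidef_one_add_majoranaOp T (Or.inl rfl)).smul (by linarith)).add
      ((posSemidef_one_add_majoranaOp T (Or.inr rfl)).smul (by linarith))).smul (by positivity)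
  trace_eq_one := by
    rw [majoranaState_eq, Matrix.trace_add, Matrix.trace_smul, Matrix.trace_smul,
      trace_majoranaOp hk, Matrix.trace_one]
    simp
  even x y hxy := by
    have hne : x ≠ y := fun h => hxy (congrArg _ h)
    rw [majoranaState_eq, Matrix.add_apply, Matrix.smul_apply, Matrix.smul_apply,
      majoranaOp_even T hxy, Matrix.one_apply_ne hne]
    simp

theorem expectation_majoranaState (T : MajoranaIndex N k) (δ : ℝ) (O : Operator (Fin N)) :
    expectation (majoranaState T δ) O =
      O.trace / 2 ^ N + δ * ((majoranaOp T * O).trace / 2 ^ N) := by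
  rw [expectation, majoranaState_eq, add_mul, Matrix.trace_add, smul_mul_assoc, smul_mul_assoc,
    Matrix.trace_smul, Matrix.trace_smul, one_mul]
  simp only [smul_eq_mul]
  push_cast
  ring

theorem prob_majoranaState {a : ℕ} (U : CliffordCircuit N a) (T : MajoranaIndex N k) (δ : ℝ)
    (z : Outcome N a) :
    U.prob (majoranaState T δ) z =
      ((2 : ℝ) ^ N)⁻¹ * U.prob 1 z + δ * (((2 : ℝ) ^ N)⁻¹ * U.prob (majoranaOp T) z) := by
  rw [majoranaState_eq, U.prob_add, U.prob_smul, U.prob_smul, mul_assoc]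

end MajoranaState

/-! ### Majorana components of the elements of the RDM -/

/-- The normalized trace `Tr (⨂_q D q) / 2 ^ |Q|` of a tensor product. -/
noncomputable def normalizedTrace {Q : Type} [Fintype Q] (D : Q → Matrix Bool Bool ℂ) : ℂ :=
  ∏ q, (D q).trace / 2

section NormalizedTrace

variable {Q : Type} [Fintype Q]

theorem normalizedTrace_mul {D D' : Q → Matrix Bool Bool ℂ} (h : ∀ q, D q = 1 ∨ D' q = 1) :
    normalizedTrace (fun q => D q * D' q) = normalizedTrace D * normalizedTrace D' := by
  rw [normalizedTrace, normalizedTrace, normalizedTrace, ← Finset.prod_mul_distrib]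
  refine Finset.prod_congr rfl fun q _ => ?_
  rcases h q with h | h <;> simp [h]

theorem normalizedTrace_update [DecidableEq Q] (m : Q) (B : Matrix Bool Bool ℂ) :
    normalizedTrace (Function.update (fun _ => 1) m B) = B.trace / 2 := by
  rw [normalizedTrace, Finset.prod_eq_single m]
  · simp
  · intro q _ hq
    simp [hq]
  · simp

theorem trace_tensor_eq_normalizedTrace [DecidableEq Q] (D : Q → Matrix Bool Bool ℂ) :
    (tensor D).trace = 2 ^ Fintype.card Q * normalizedTrace D := by
  rw [trace_tensor, normalizedTrace, Finset.prod_div_distrib, Finset.prod_const, Finset.card_univ]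
  field_simp

end NormalizedTrace

section Reorder

variable {N : ℕ}

theorem majorana_mul_creation {a : Fin (2 * N)} {m : Fin N} (h : mode a ≠ m) :
    EqUpToSign (creation m * majorana a) (majorana a * creation m) := by
  rw [majorana_eq_jordanWigner, creation_eq_jordanWigner]
  exact Or.inr (jordanWigner_anticomm h.symm lowering_conjTranspose_anticomm
    (majoranaLetter_anticomm a))

theorem majorana_mul_annihilation {a : Fin (2 * N)} {m : Fin N} (h : mode a ≠ m) :
    EqUpToSign (annihilation m * majorana a) (majorana a * annihilation m) := by
  rw [majorana_eq_jordanWigner, annihilation_eq_jordanWigner]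
  exact Or.inr (jordanWigner_anticomm h.symm lowering_anticomm (majoranaLetter_anticomm a))

theorem creation_mul_annihilation {m m' : Fin N} (h : m ≠ m') :
    EqUpToSign (annihilation m' * creation m) (creation m * annihilation m') := by
  rw [creation_eq_jordanWigner, annihilation_eq_jordanWigner]
  exact Or.inr (jordanWigner_anticomm h.symm lowering_anticomm lowering_conjTranspose_anticomm)

theorem norm_trace_letter_mul_lowering (a : Fin (2 * N)) :
    ‖((majoranaLetter a).toMatrix * lowering).trace‖ = 1 := by
  unfold majoranaLetter
  split_ifs <;> simp [Matrix.trace, Matrix.mul_apply, lowering, PauliLetter.toMatrix]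

theorem norm_trace_letter_mul_raising (a : Fin (2 * N)) :
    ‖((majoranaLetter a).toMatrix * loweringᴴ).trace‖ = 1 := by
  unfold majoranaLetter
  split_ifs <;> simp [Matrix.trace, Matrix.mul_apply, lowering, PauliLetter.toMatrix]

theorem norm_trace_letters_mul_number {a b : Fin (2 * N)} (hab : a ≠ b) (h : mode a = mode b) :
    ‖((majoranaLetter a).toMatrix * (majoranaLetter b).toMatrix * (loweringᴴ * lowering)).trace‖ =
      1 := by
  have h1 : a.val / 2 = b.val / 2 := congrArg Fin.val h
  have h2 : a.val ≠ b.val := fun h => hab (Fin.ext h)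
  unfold majoranaLetter
  split_ifs
  · omega
  · simp [Matrix.trace, Matrix.mul_apply, lowering, PauliLetter.toMatrix]
  · simp [Matrix.trace, Matrix.mul_apply, lowering, PauliLetter.toMatrix]
  · omega

/-- The component of `c†_p c_q` along `γ_a γ_b`, where `p` and `q` are the modes of `a` and `b`. -/
theorem exists_tensor_majorana_pair {a b : Fin (2 * N)} (hab : a ≠ b) :
    ∃ D : Fin N → Matrix Bool Bool ℂ,
      EqUpToSign (majorana a * majorana b * creation (mode a) * annihilation (mode b)) (tensor D) ∧
      (∀ q, q ≠ mode a → q ≠ mode b → D q = 1) ∧ 1 / 4 ≤ ‖normalizedTrace D‖ := by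
  by_cases h : mode a = mode b
  · refine ⟨Function.update (fun _ => 1) (mode b) ((majoranaLetter a).toMatrix *
      (majoranaLetter b).toMatrix * (loweringᴴ * lowering)), Or.inl ?_, fun q _ hq => by simp [hq],
      ?_⟩
    · rw [majorana_eq_jordanWigner, majorana_eq_jordanWigner, creation_eq_jordanWigner,
        annihilation_eq_jordanWigner, h, jordanWigner_mul, mul_assoc, jordanWigner_mul, tensor_mul]
      congr 1
      funext q
      by_cases hq : q = mode b
      · subst hq; simp
      · simp [hq]
    · rw [normalizedTrace_update, norm_div, norm_trace_letters_mul_number hab h]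
      norm_num
  · have h1 : ∀ q, Function.update (fun _ => (1 : Matrix Bool Bool ℂ)) (mode a)
        ((majoranaLetter a).toMatrix * loweringᴴ) q = 1 ∨
        Function.update (fun _ => (1 : Matrix Bool Bool ℂ)) (mode b)
          ((majoranaLetter b).toMatrix * lowering) q = 1 := by
      intro q
      by_cases hq : q = mode a
      · subst hq; simp [h]
      · simp [hq]
    refine ⟨fun q => Function.update (fun _ => 1) (mode a) ((majoranaLetter a).toMatrix *
      loweringᴴ) q * Function.update (fun _ => 1) (mode b) ((majoranaLetter b).toMatrix * lowering)
        q, ?_, fun q hq hq' => ?_, ?_⟩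
    · have h2 := ((EqUpToSign.refl (majorana a)).mul
        (majorana_mul_creation (Ne.symm h)).symm).mul (EqUpToSign.refl (annihilation (mode b)))
      have h3 : majorana a * (creation (mode a) * majorana b) * annihilation (mode b) = tensor _ :=
        calc _ = (majorana a * creation (mode a)) * (majorana b * annihilation (mode b)) := by
              simp only [mul_assoc]
          _ = _ := by
              rw [majorana_eq_jordanWigner, majorana_eq_jordanWigner, creation_eq_jordanWigner,
                annihilation_eq_jordanWigner, jordanWigner_mul, jordanWigner_mul, tensor_mul]
      rw [h3, ← mul_assoc] at h2
      exact h2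
    · simp [hq, hq']
    · rw [normalizedTrace_mul h1, normalizedTrace_update, normalizedTrace_update, norm_mul, norm_div, norm_div,
        norm_trace_letter_mul_lowering, norm_trace_letter_mul_raising]
      norm_num

end Reorder

/-- From a set of at least two Majorana indices one can split off two that share no mode with the
remaining ones: a full mode if there is one, and any two indices otherwise. -/
theorem exists_pair_of_disjoint_modes {N : ℕ} {T : Finset (Fin (2 * N))} (hT : 2 ≤ T.card) :
    ∃ a ∈ T, ∃ b ∈ T, a ≠ b ∧ ∀ c ∈ T, c ≠ a → c ≠ b → mode c ≠ mode a ∧ mode c ≠ mode b := by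
  have hval : ∀ {a b : Fin (2 * N)}, mode a = mode b → a.val / 2 = b.val / 2 :=
    fun h => congrArg Fin.val h
  by_cases h : ∃ a ∈ T, ∃ b ∈ T, a ≠ b ∧ mode a = mode b
  · obtain ⟨a, ha, b, hb, hab, hm⟩ := h
    refine ⟨a, ha, b, hb, hab, fun c _ hca hcb => ?_⟩
    have h1 := hval hm
    have h2 : a.val ≠ b.val := fun h => hab (Fin.ext h)
    have h3 : c.val ≠ a.val := fun h => hca (Fin.ext h)
    have h4 : c.val ≠ b.val := fun h => hcb (Fin.ext h)
    constructor
    · intro hc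
      have := hval hc
      omega
    · intro hc
      have := hval hc
      omega
  · push Not at h
    obtain ⟨a, ha, b, hb, hab⟩ := Finset.one_lt_card.mp hT
    exact ⟨a, ha, b, hb, hab, fun c hc hca hcb => ⟨h c hc a ha hca, h c hc b hb hcb⟩⟩

/-- For a suitable element `e` of the `k`-RDM, the product of `rdmOp e` with the Majorana operators in
`T` is, up to sign, a tensor product of large normalized trace. By induction on `k`: split off a pair
of indices with `exists_pair_of_disjoint_modes`, let `c†_p c_q` act on the modes of this pair, and
reorder; different modes only produce signs. -/
theorem exists_rdm_tensor {N : ℕ} (k : ℕ) (T : Finset (Fin (2 * N))) (hT : T.card = 2 * k) :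
    ∃ (l : List (Fin (2 * N))) (e : RDMIndex N k) (D : Fin N → Matrix Bool Bool ℂ),
      l.Nodup ∧ l.toFinset = T ∧ EqUpToSign ((l.map majorana).prod * rdmOp e) (tensor D) ∧
      (∀ i, ∃ c ∈ T, mode c = e.1 i) ∧ (∀ q, (∀ c ∈ T, mode c ≠ q) → D q = 1) ∧
      (1 / 4) ^ k ≤ ‖normalizedTrace D‖ := by
  induction k generalizing T with
  | zero =>
    have hT0 : T = ∅ := Finset.card_eq_zero.mp hT
    subst hT0
    refine ⟨[], ⟨Fin.elim0, Fin.elim0⟩, fun _ => 1, List.nodup_nil, rfl, Or.inl ?_,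
      fun i => i.elim0, fun _ _ => rfl, ?_⟩
    · simp [rdmOp, tensor_one]
    · simp [normalizedTrace]
  | succ k ih =>
    obtain ⟨a, ha, b, hb, hab, hmode⟩ := exists_pair_of_disjoint_modes (T := T) (by omega)
    have hb' : b ∈ T.erase a := Finset.mem_erase.mpr ⟨hab.symm, hb⟩
    have hmem : ∀ c, c ∈ (T.erase a).erase b ↔ c ≠ b ∧ c ≠ a ∧ c ∈ T := by
      simp [Finset.mem_erase]
    obtain ⟨l, e, D, hl, hlT, hD, he, hD1, hnorm⟩ := ih ((T.erase a).erase b) (by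
      rw [Finset.card_erase_of_mem hb', Finset.card_erase_of_mem ha, hT]; omega)
    have hlmem : ∀ c, c ∈ l ↔ c ≠ b ∧ c ≠ a ∧ c ∈ T := fun c => by
      rw [← hmem, ← hlT, List.mem_toFinset]
    have hmodes : ∀ c ∈ (T.erase a).erase b, mode c ≠ mode a ∧ mode c ≠ mode b := fun c hc =>
      hmode c ((hmem c).mp hc).2.2 ((hmem c).mp hc).2.1 ((hmem c).mp hc).1
    obtain ⟨E, hE, hE1, hEnorm⟩ := exists_tensor_majorana_pair hab
    have hdisj : ∀ q, E q = 1 ∨ D q = 1 := by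
      intro q
      by_cases hq : q ≠ mode a ∧ q ≠ mode b
      · exact Or.inl (hE1 q hq.1 hq.2)
      · refine Or.inr (hD1 q fun c hc hcq => hq ?_)
        rw [← hcq]
        exact hmodes c hc
    refine ⟨a :: b :: l, ⟨Fin.cons (mode a) e.1, Fin.cons (mode b) e.2⟩, fun q => E q * D q,
      ?_, ?_, ?_, ?_, ?_, ?_⟩
    · simp [hlmem, hl, hab]
    · ext c
      simp only [List.toFinset_cons, Finset.mem_insert, List.mem_toFinset, hlmem]
      constructor
      · rintro (rfl | rfl | h)
        exacts [ha, hb, h.2.2]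
      · tauto
    · set G := (l.map majorana).prod with hG
      set A := (List.ofFn fun i => creation (e.1 i)).prod with hA
      set B := (List.ofFn fun i => annihilation (e.2 i)).prod with hB
      have hl1 : ∀ c ∈ l, mode c ≠ mode a ∧ mode c ≠ mode b := fun c hc =>
        hmodes c ((hmem c).mpr ((hlmem c).mp hc))
      have h1 : EqUpToSign (G * creation (mode a)) (creation (mode a) * G) := by
        refine (EqUpToSign.mul_prod_comm fun y hy => ?_).symm
        obtain ⟨c, hc, rfl⟩ := List.mem_map.mp hy
        exact majorana_mul_creation (hl1 c hc).1
      have h2 : EqUpToSign (G * annihilation (mode b)) (annihilation (mode b) * G) := by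
        refine (EqUpToSign.mul_prod_comm fun y hy => ?_).symm
        obtain ⟨c, hc, rfl⟩ := List.mem_map.mp hy
        exact majorana_mul_annihilation (hl1 c hc).2
      have h3 : EqUpToSign (A * annihilation (mode b)) (annihilation (mode b) * A) := by
        refine (EqUpToSign.mul_prod_comm fun y hy => ?_).symm
        obtain ⟨i, rfl⟩ := (List.mem_ofFn' _ _).mp hy
        obtain ⟨c, hc, hci⟩ := he i
        exact creation_mul_annihilation (hci ▸ (hmodes c hc).2)
      have h4 := (((EqUpToSign.refl (majorana a * majorana b)).mul h1).mul h3).mul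
        (EqUpToSign.refl B)
      have h5 := ((EqUpToSign.refl (majorana a * majorana b * creation (mode a))).mul h2).mul
        (EqUpToSign.refl (A * B))
      have h6 := hE.mul hD
      rw [tensor_mul, rdmOp, ← hA, ← hB] at h6
      have hrdm : rdmOp (N := N) (k := k + 1) ⟨Fin.cons (mode a) e.1, Fin.cons (mode b) e.2⟩ =
          creation (mode a) * A * (annihilation (mode b) * B) := by
        simp only [rdmOp, List.ofFn_succ, List.prod_cons, Fin.cons_zero, Fin.cons_succ, hA, hB]
      rw [hrdm]
      simp only [List.map_cons, List.prod_cons, ← hG, ← mul_assoc] at h4 h5 h6 ⊢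
      exact (h4.trans h5).trans h6
    · intro i
      refine Fin.cases ⟨a, ha, rfl⟩ (fun i => ?_) i
      obtain ⟨c, hc, hci⟩ := he i
      exact ⟨c, ((hmem c).mp hc).2.2, by simpa using hci⟩
    · intro q hq
      change E q * D q = 1
      rw [hE1 q (hq a ha).symm (hq b hb).symm, hD1 q fun c hc => hq c ((hmem c).mp hc).2.2,
        mul_one]
    · rw [normalizedTrace_mul hdisj, norm_mul, pow_succ, mul_comm]
      exact mul_le_mul hEnorm hnorm (by positivity) (norm_nonneg _)

/-- Every Majorana operator of degree `2 k` has a component of modulus at least `4 ^ (-k)` in some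
element of the `k`-RDM. -/
theorem exists_rdm_component {N k : ℕ} (T : MajoranaIndex N k) :
    ∃ e : RDMIndex N k, (1 / 4) ^ k ≤ ‖(majoranaOp T * rdmOp e).trace / 2 ^ N‖ := by
  obtain ⟨l, e, D, hl, hlT, hD, -, -, hnorm⟩ := exists_rdm_tensor k T.1 T.2
  refine ⟨e, hnorm.trans (le_of_eq ?_)⟩
  obtain ⟨w, hw, hT⟩ := majoranaOp_eqUpToSign_smul T hl hlT
  rw [hT, smul_mul_assoc, Matrix.trace_smul, smul_eq_mul, mul_div_assoc, norm_mul, hw, one_mul]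
  have h : ‖(tensor D).trace / 2 ^ N‖ = ‖normalizedTrace D‖ := by
    rw [trace_tensor_eq_normalizedTrace, Fintype.card_fin, mul_div_cancel_left₀]
    positivity
  rcases hD with hD | hD
  · rw [hD, h]
  · rw [hD, Matrix.trace_neg, neg_div, norm_neg, h]

/-! ### Families of sets with even intersections -/

section EvenFamily

variable {α : Type} [DecidableEq α]

/-- Sets of size `2 k` with pairwise even intersections: the sets through a point `x` all meet a
fixed one of them in a second point `y`, and removing `x` and `y` leaves a family of the same kind
with `k - 1` in place of `k`. -/
theorem card_le_pow_of_even_inter [Fintype α] (k : ℕ) (F : Finset (Finset α))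
    (hcard : ∀ T ∈ F, T.card = 2 * k) (heven : ∀ T ∈ F, ∀ T' ∈ F, Even (T ∩ T').card) :
    F.card ≤ Fintype.card α ^ k := by
  induction k generalizing F with
  | zero =>
    rw [pow_zero]
    refine Finset.card_le_one.mpr fun T hT T' hT' => ?_
    rw [Finset.card_eq_zero.mp (hcard T hT), Finset.card_eq_zero.mp (hcard T' hT')]
  | succ k ih =>
    have hxy : ∀ x y, x ≠ y → (F.filter fun T => x ∈ T ∧ y ∈ T).card ≤ Fintype.card α ^ k := by
      intro x y hxy
      set H := F.filter fun T => x ∈ T ∧ y ∈ T with hH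
      have hmem : ∀ T ∈ H, T ∈ F ∧ x ∈ T ∧ y ∈ T.erase x := fun T hT => by
        have := Finset.mem_filter.mp hT
        exact ⟨this.1, this.2.1, Finset.mem_erase.mpr ⟨hxy.symm, this.2.2⟩⟩
      have hinj : Set.InjOn (fun T : Finset α => (T.erase x).erase y) H := by
        intro T hT T' hT' h
        obtain ⟨-, hx, hy⟩ := hmem T hT
        obtain ⟨-, hx', hy'⟩ := hmem T' hT'
        have h' : (T.erase x).erase y = (T'.erase x).erase y := h
        rw [← Finset.insert_erase hx, ← Finset.insert_erase hy, h', Finset.insert_erase hy',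
          Finset.insert_erase hx']
      rw [← Finset.card_image_of_injOn hinj]
      apply ih
      · intro S hS
        obtain ⟨T, hT, rfl⟩ := Finset.mem_image.mp hS
        obtain ⟨hF, hx, hy⟩ := hmem T hT
        rw [Finset.card_erase_of_mem hy, Finset.card_erase_of_mem hx, hcard T hF]
        omega
      · intro S hS S' hS'
        obtain ⟨T, hT, rfl⟩ := Finset.mem_image.mp hS
        obtain ⟨T', hT', rfl⟩ := Finset.mem_image.mp hS'
        obtain ⟨hF, hx, hy⟩ := hmem T hT
        obtain ⟨hF', hx', hy'⟩ := hmem T' hT'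
        have h1 : (T.erase x).erase y ∩ (T'.erase x).erase y = ((T ∩ T').erase x).erase y := by
          ext c
          simp only [Finset.mem_inter, Finset.mem_erase]
          tauto
        have hy2 : y ∈ (T ∩ T').erase x := by
          simp only [Finset.mem_inter, Finset.mem_erase] at hy hy' ⊢
          tauto
        have h2 := Finset.card_erase_add_one hy2
        have h3 := Finset.card_erase_add_one (Finset.mem_inter.mpr ⟨hx, hx'⟩)
        obtain ⟨m, hm⟩ := heven T hF T' hF'
        rw [h1]
        exact ⟨m - 1, by omega⟩
    have hx : ∀ x, (F.filter fun T => x ∈ T).card ≤ (2 * k + 1) * Fintype.card α ^ k := by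
      intro x
      rcases (F.filter fun T => x ∈ T).eq_empty_or_nonempty with h0 | ⟨T₀, hT₀⟩
      · rw [h0]; simp
      · rw [Finset.mem_filter] at hT₀
        have hsub : (F.filter fun T => x ∈ T) ⊆
            (T₀.erase x).biUnion fun y => F.filter fun T => x ∈ T ∧ y ∈ T := by
          intro T hT
          rw [Finset.mem_filter] at hT
          have hxi : x ∈ T ∩ T₀ := Finset.mem_inter.mpr ⟨hT.2, hT₀.2⟩
          have hpos : 1 < (T ∩ T₀).card := by
            obtain ⟨m, hm⟩ := heven T hT.1 T₀ hT₀.1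
            have := Finset.card_pos.mpr ⟨x, hxi⟩
            omega
          obtain ⟨y, hy, hyx⟩ := Finset.exists_mem_ne hpos x
          rw [Finset.mem_inter] at hy
          exact Finset.mem_biUnion.mpr ⟨y, Finset.mem_erase.mpr ⟨hyx, hy.2⟩,
            Finset.mem_filter.mpr ⟨hT.1, hT.2, hy.1⟩⟩
        refine (Finset.card_le_card hsub).trans ((Finset.card_biUnion_le_card_mul _ _ _
          fun y hy => hxy x y (Finset.ne_of_mem_erase hy).symm).trans (le_of_eq ?_))
        rw [Finset.card_erase_of_mem hT₀.2, hcard T₀ hT₀.1]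
        rfl
    have hsum : ∑ T ∈ F, T.card ≤ Fintype.card α * ((2 * k + 1) * Fintype.card α ^ k) :=
      Finset.sum_card_le hx
    rw [Finset.sum_congr rfl hcard, Finset.sum_const, smul_eq_mul] at hsum
    have h1 : F.card * (2 * (k + 1)) ≤ Fintype.card α ^ (k + 1) * (2 * (k + 1)) := by
      rw [pow_succ]
      calc _ ≤ _ := hsum
        _ = Fintype.card α ^ k * Fintype.card α * (2 * k + 1) := by ring
        _ ≤ _ := Nat.mul_le_mul_left _ (by omega)
    exact Nat.le_of_mul_le_mul_right h1 (by omega)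

theorem two_mul_card_le_of_even_inter [Fintype α] (F : Finset (Finset α))
    (hcard : ∀ T ∈ F, T.card = 2) (heven : ∀ T ∈ F, ∀ T' ∈ F, Even (T ∩ T').card) :
    2 * F.card ≤ Fintype.card α := by
  have hx : ∀ x, (F.filter fun T => x ∈ T).card ≤ 1 := by
    intro x
    refine Finset.card_le_one.mpr fun T hT T' hT' => ?_
    rw [Finset.mem_filter] at hT hT'
    have hpos := Finset.card_pos.mpr ⟨x, Finset.mem_inter.mpr ⟨hT.2, hT'.2⟩⟩
    obtain ⟨m, hm⟩ := heven T hT.1 T' hT'.1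
    have h1 := Finset.eq_of_subset_of_card_le (Finset.inter_subset_left (s₁ := T) (s₂ := T'))
      (by rw [hcard T hT.1]; omega)
    have h2 := Finset.eq_of_subset_of_card_le (Finset.inter_subset_right (s₁ := T) (s₂ := T'))
      (by rw [hcard T' hT'.1]; omega)
    exact h1.symm.trans h2
  have hsum : ∑ T ∈ F, T.card ≤ Fintype.card α * 1 := Finset.sum_card_le hx
  rw [Finset.sum_congr rfl hcard, Finset.sum_const, smul_eq_mul] at hsum
  omega

/-- Triples that pairwise meet in exactly one point either share a point, or there are at most seven
of them (as in the Fano plane). -/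
theorem card_triples_le {V : Finset α} {G : Finset (Finset α)} (hV : ∀ A ∈ G, A ⊆ V)
    (hcard : ∀ A ∈ G, A.card = 3) (hinter : ∀ A ∈ G, ∀ B ∈ G, A ≠ B → (A ∩ B).card = 1) :
    G.card ≤ 7 ∨ 2 * G.card + 1 ≤ V.card := by
  have hpair : ∀ y z, y ≠ z → (G.filter fun A => y ∈ A ∧ z ∈ A).card ≤ 1 := by
    intro y z hyz
    refine Finset.card_le_one.mpr fun A hA B hB => ?_
    rw [Finset.mem_filter] at hA hB
    by_contra hne
    have h1 := hinter A hA.1 B hB.1 hne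
    exact hyz (Finset.card_le_one.mp h1.le y (Finset.mem_inter.mpr ⟨hA.2.1, hB.2.1⟩) z
      (Finset.mem_inter.mpr ⟨hA.2.2, hB.2.2⟩))
  rcases G.eq_empty_or_nonempty with rfl | ⟨A₀, hA₀⟩
  · simp
  by_cases hstar : ∃ y, ∀ A ∈ G, y ∈ A
  · right
    obtain ⟨y, hy⟩ := hstar
    have hsum : ∑ A ∈ G, ((V.erase y) ∩ A).card ≤ (V.erase y).card * 1 := by
      refine Finset.sum_card_inter_le fun z hz => le_trans (Finset.card_le_card fun A hA => ?_)
        (hpair y z (Finset.ne_of_mem_erase hz).symm)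
      rw [Finset.mem_filter] at hA ⊢
      exact ⟨hA.1, hy A hA.1, hA.2⟩
    have hterm : ∀ A ∈ G, ((V.erase y) ∩ A).card = 2 := by
      intro A hA
      rw [Finset.erase_inter, Finset.inter_eq_right.mpr (hV A hA),
        Finset.card_erase_of_mem (hy A hA), hcard A hA]
    rw [Finset.sum_congr rfl hterm, Finset.sum_const, smul_eq_mul] at hsum
    have := Finset.card_erase_add_one (hV A₀ hA₀ (hy A₀ hA₀))
    omega
  · left
    push Not at hstar
    have hdeg : ∀ y, (G.filter fun A => y ∈ A).card ≤ 3 := by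
      intro y
      obtain ⟨B, hB, hyB⟩ := hstar y
      have hsum : ∑ A ∈ G.filter (fun A => y ∈ A), (B ∩ A).card ≤ B.card * 1 := by
        refine Finset.sum_card_inter_le fun z hz => ?_
        rw [Finset.filter_filter]
        exact hpair y z fun h => hyB (h ▸ hz)
      have hterm : ∀ A ∈ G.filter (fun A => y ∈ A), (B ∩ A).card = 1 := by
        intro A hA
        rw [Finset.mem_filter] at hA
        exact hinter B hB A hA.1 fun h => hyB (h ▸ hA.2)
      rw [Finset.sum_congr rfl hterm, Finset.sum_const, hcard B hB] at hsum
      simpa using hsum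
    have hsum : ∑ A ∈ G, (A₀ ∩ A).card ≤ A₀.card * 3 :=
      Finset.sum_card_inter_le fun y _ => hdeg y
    rw [← Finset.add_sum_erase G _ hA₀, Finset.inter_self, hcard A₀ hA₀,
      Finset.sum_congr rfl fun A hA => hinter A₀ hA₀ A (Finset.mem_of_mem_erase hA)
        (Finset.ne_of_mem_erase hA).symm, Finset.sum_const, Finset.card_erase_of_mem hA₀] at hsum
    simp only [smul_eq_mul, mul_one] at hsum
    omega

/-- For `N ≥ 8` no point lies in more than `N - 1` sets, since the bound `7` of `card_triples_le`
on triples without a common point is then at most `N - 1`. -/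
theorem two_mul_card_four_sets_le [Fintype α] {N : ℕ} (hN : 8 ≤ N) (hα : Fintype.card α = 2 * N)
    (F : Finset (Finset α)) (hcard : ∀ T ∈ F, T.card = 4)
    (heven : ∀ T ∈ F, ∀ T' ∈ F, Even (T ∩ T').card) : 2 * F.card ≤ N * (N - 1) := by
  have hx : ∀ x, (F.filter fun T => x ∈ T).card ≤ N - 1 := by
    intro x
    have hinj : Set.InjOn (fun T : Finset α => T.erase x) (F.filter fun T => x ∈ T) := by
      intro T hT T' hT' h
      have h' : T.erase x = T'.erase x := h
      rw [← Finset.insert_erase (Finset.mem_filter.mp hT).2, h',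
        Finset.insert_erase (Finset.mem_filter.mp hT').2]
    rw [← Finset.card_image_of_injOn hinj]
    have htri := card_triples_le (V := Finset.univ.erase x)
      (G := (F.filter fun T => x ∈ T).image fun T => T.erase x) ?_ ?_ ?_
    · rw [Finset.card_erase_of_mem (Finset.mem_univ x), Finset.card_univ, hα] at htri
      omega
    · intro A hA
      obtain ⟨T, hT, rfl⟩ := Finset.mem_image.mp hA
      exact Finset.erase_subset_erase x (Finset.subset_univ T)
    · intro A hA
      obtain ⟨T, hT, rfl⟩ := Finset.mem_image.mp hA
      rw [Finset.mem_filter] at hT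
      rw [Finset.card_erase_of_mem hT.2, hcard T hT.1]
    · intro A hA B hB hne
      obtain ⟨T, hT, rfl⟩ := Finset.mem_image.mp hA
      obtain ⟨T', hT', rfl⟩ := Finset.mem_image.mp hB
      rw [Finset.mem_filter] at hT hT'
      have hne' : T ≠ T' := fun h => hne (by rw [h])
      have hxi : x ∈ T ∩ T' := Finset.mem_inter.mpr ⟨hT.2, hT'.2⟩
      have h1 : T.erase x ∩ T'.erase x = (T ∩ T').erase x := by
        ext c
        simp only [Finset.mem_inter, Finset.mem_erase]
        tauto
      have h2 : (T ∩ T').card < 4 := by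
        by_contra hge
        have e1 := Finset.eq_of_subset_of_card_le (Finset.inter_subset_left (s₁ := T) (s₂ := T'))
          (by rw [hcard T hT.1]; omega)
        have e2 := Finset.eq_of_subset_of_card_le (Finset.inter_subset_right (s₁ := T) (s₂ := T'))
          (by rw [hcard T' hT'.1]; omega)
        exact hne' (e1.symm.trans e2)
      obtain ⟨m, hm⟩ := heven T hT.1 T' hT'.1
      have hpos := Finset.card_pos.mpr ⟨x, hxi⟩
      rw [h1, Finset.card_erase_of_mem hxi]
      omega
  have hsum : ∑ T ∈ F, T.card ≤ Fintype.card α * (N - 1) := Finset.sum_card_le hx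
  rw [Finset.sum_congr rfl hcard, Finset.sum_const, smul_eq_mul, hα, mul_assoc] at hsum
  omega

end EvenFamily

/-! ### Sizes of cliques of Majorana operators -/

section CliqueSize

open Classical in
/-- The labels of the `2 k`-Majorana operators in a set of operators. -/
noncomputable def majoranaLabels {N : ℕ} (k : ℕ) (C : Set (Operator (Fin N))) :
    Finset (MajoranaIndex N k) :=
  Finset.univ.filter fun T => majoranaOp T ∈ C

variable {N k : ℕ} {C : Set (Operator (Fin N))}

theorem mem_majoranaLabels {T : MajoranaIndex N k} :
    T ∈ majoranaLabels k C ↔ majoranaOp T ∈ C := by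
  simp [majoranaLabels]

theorem even_inter_of_pairwise_commute (hC : C.Pairwise Commute) {T T' : MajoranaIndex N k}
    (hT : T ∈ majoranaLabels k C) (hT' : T' ∈ majoranaLabels k C) : Even (T.1 ∩ T'.1).card := by
  rw [mem_majoranaLabels] at hT hT'
  apply even_inter_of_commute
  by_cases h : majoranaOp T = majoranaOp T'
  · rw [h]
  · exact hC hT hT' h

/-- The index sets of the labels in a commuting clique form a family with even intersections. -/
theorem exists_even_family (hC : C.Pairwise Commute) :
    ∃ F : Finset (Finset (Fin (2 * N))), F.card = (majoranaLabels k C).card ∧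
      (∀ T ∈ F, T.card = 2 * k) ∧ ∀ T ∈ F, ∀ T' ∈ F, Even (T ∩ T').card := by
  refine ⟨(majoranaLabels k C).map (Function.Embedding.subtype _), Finset.card_map _, ?_, ?_⟩
  · intro S hS
    obtain ⟨T, -, rfl⟩ := Finset.mem_map.mp hS
    exact T.2
  · intro S hS S' hS'
    obtain ⟨T, hT, rfl⟩ := Finset.mem_map.mp hS
    obtain ⟨T', hT', rfl⟩ := Finset.mem_map.mp hS'
    exact even_inter_of_pairwise_commute hC hT hT'

theorem card_majoranaLabels_le_pow (hC : C.Pairwise Commute) :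
    (majoranaLabels k C).card ≤ (2 * N) ^ k := by
  obtain ⟨F, hF, hcard, heven⟩ := exists_even_family (k := k) hC
  rw [← hF]
  simpa using card_le_pow_of_even_inter k F hcard heven

theorem card_majoranaLabels_one_le (hC : C.Pairwise Commute) :
    (majoranaLabels 1 C).card ≤ N := by
  obtain ⟨F, hF, hcard, heven⟩ := exists_even_family (k := 1) hC
  have h := two_mul_card_le_of_even_inter F hcard heven
  rw [Fintype.card_fin] at h
  omega

theorem two_mul_card_majoranaLabels_two_le (hN : 8 ≤ N) (hC : C.Pairwise Commute) :
    2 * (majoranaLabels 2 C).card ≤ N * (N - 1) := by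
  obtain ⟨F, hF, hcard, heven⟩ := exists_even_family (k := 2) hC
  rw [← hF]
  exact two_mul_card_four_sets_le hN (Fintype.card_fin _) F hcard heven

theorem card_majoranaIndex (N k : ℕ) :
    Fintype.card (MajoranaIndex N k) = (2 * N).choose (2 * k) := by
  rw [Fintype.card_finset_len, Fintype.card_fin]

theorem choose_le_sum_card_majoranaLabels {𝒞 : Finset (Set (Operator (Fin N)))}
    (h : IsCommutingCliqueCover k 𝒞) :
    (2 * N).choose (2 * k) ≤ ∑ C ∈ 𝒞, (majoranaLabels k C).card := by
  classical
  rw [← card_majoranaIndex, ← Finset.card_univ]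
  refine (Finset.card_le_card fun T _ => ?_).trans Finset.card_biUnion_le
  obtain ⟨C, hC, hT⟩ := h.2 T
  exact Finset.mem_biUnion.mpr ⟨C, hC, mem_majoranaLabels.mpr hT⟩

theorem card_cover_one {𝒞 : Finset (Set (Operator (Fin N)))} (h : IsCommutingCliqueCover 1 𝒞) :
    2 * (N : ℝ) - 1 ≤ (𝒞.card : ℝ) := by
  have h1 := (choose_le_sum_card_majoranaLabels h).trans (Finset.sum_le_card_nsmul _ _ _
    fun C hC => card_majoranaLabels_one_le (h.1 C hC))
  rw [Nat.choose_two_right, mul_assoc, Nat.mul_div_cancel_left _ two_pos, smul_eq_mul,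
    mul_comm 𝒞.card] at h1
  rcases Nat.eq_zero_or_pos N with rfl | hN
  · simp only [CharP.cast_eq_zero, mul_zero, zero_sub]
    linarith [(𝒞.card.cast_nonneg : (0 : ℝ) ≤ _)]
  · have h2 := Nat.le_of_mul_le_mul_left h1 hN
    have h3 : 2 * N ≤ 𝒞.card + 1 := by omega
    have h4 : (2 * N : ℝ) ≤ 𝒞.card + 1 := by exact_mod_cast h3
    linarith

theorem card_cover_two (hN : 8 ≤ N) {𝒞 : Finset (Set (Operator (Fin N)))}
    (h : IsCommutingCliqueCover 2 𝒞) :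
    4 / 3 * (N : ℝ) ^ 2 - 8 / 3 * (N : ℝ) + 1 ≤ (𝒞.card : ℝ) := by
  have h1 : 2 * (2 * N).choose (2 * 2) ≤ 𝒞.card * (N * (N - 1)) := by
    refine (Nat.mul_le_mul_left 2 (choose_le_sum_card_majoranaLabels h)).trans ?_
    rw [Finset.mul_sum, ← smul_eq_mul 𝒞.card]
    exact Finset.sum_le_card_nsmul _ _ _
      fun C hC => two_mul_card_majoranaLabels_two_le hN (h.1 C hC)
  have h2 : (2 * N).descFactorial 4 = 24 * (2 * N).choose 4 :=
    Nat.descFactorial_eq_factorial_mul_choose _ _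
  obtain ⟨m, rfl⟩ : ∃ m, N = m + 2 := ⟨N - 2, by omega⟩
  have h3 : (2 * (m + 2)).descFactorial 4 =
      (2 * m + 1) * ((2 * m + 2) * ((2 * m + 3) * (2 * m + 4))) := by
    simp only [Nat.descFactorial, Nat.sub_zero]
    rw [show 2 * (m + 2) - 3 = 2 * m + 1 by omega, show 2 * (m + 2) - 2 = 2 * m + 2 by omega,
      show 2 * (m + 2) - 1 = 2 * m + 3 by omega]
    ring
  rw [show m + 2 - 1 = m + 1 by omega] at h1
  have h4 : (2 * m + 1) * (2 * m + 3) * ((m + 2) * (m + 1)) ≤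
      3 * 𝒞.card * ((m + 2) * (m + 1)) := by
    have : 2 * 2 = 4 := rfl
    rw [this] at h1
    nlinarith
  have h5 := Nat.le_of_mul_le_mul_right h4 (by positivity)
  have h6 : ((2 * m + 1) * (2 * m + 3) : ℝ) ≤ 3 * 𝒞.card := by exact_mod_cast h5
  push_cast
  nlinarith

end CliqueSize

/-! ### Adaptive sequences of measurements -/

section SeqLaw

variable {α : Type}

/-- The probability of the sequence of results `x`, when `p h` is the distribution of the next
result after the results `h`. -/
def seqLaw (p : List α → α → ℝ) {M : ℕ} (x : Fin M → α) : ℝ :=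
  ∏ t : Fin M, p ((List.ofFn x).take t) (x t)

theorem seqLaw_nonneg {p : List α → α → ℝ} (hp : ∀ h z, 0 ≤ p h z) {M : ℕ} (x : Fin M → α) :
    0 ≤ seqLaw p x :=
  Finset.prod_nonneg fun _ _ => hp _ _

theorem seqLaw_cons (p : List α → α → ℝ) {M : ℕ} (z : α) (x : Fin M → α) :
    seqLaw p (Fin.cons z x : Fin (M + 1) → α) = p [] z * seqLaw (fun h => p (z :: h)) x := by
  simp only [seqLaw, Fin.prod_univ_succ, List.ofFn_cons, Fin.val_zero, List.take_zero,
    Fin.cons_zero, Fin.val_succ, List.take_succ_cons, Fin.cons_succ]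

theorem sum_fin_succ [Fintype α] {M : ℕ} (f : (Fin (M + 1) → α) → ℝ) :
    ∑ x, f x = ∑ z, ∑ x : Fin M → α, f (Fin.cons z x) := by
  rw [← (Fin.consEquiv fun _ => α).sum_comp, Fintype.sum_prod_type]
  rfl

theorem sum_seqLaw [Fintype α] {p : List α → α → ℝ} (hp : ∀ h, ∑ z, p h z = 1) (M : ℕ) :
    ∑ x : Fin M → α, seqLaw p x = 1 := by
  induction M generalizing p with
  | zero => simp [seqLaw]
  | succ M ih =>
    rw [sum_fin_succ]
    simp only [seqLaw_cons, ← Finset.mul_sum]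
    rw [Finset.sum_congr rfl fun z _ => by rw [ih fun h => hp (z :: h)]]
    simpa using hp []

/-- If the expected reward of a step is at most `C` whatever happened before, then the expected
reward of `M` steps is at most `M C`. -/
theorem sum_seqLaw_mul_sum_le [Fintype α] {p r : List α → α → ℝ} (hp0 : ∀ h z, 0 ≤ p h z)
    (hp : ∀ h, ∑ z, p h z = 1) {C : ℝ} (hr : ∀ h, ∑ z, p h z * r h z ≤ C) (M : ℕ) :
    ∑ x : Fin M → α, seqLaw p x * ∑ t : Fin M, r ((List.ofFn x).take t) (x t) ≤ M * C := by
  induction M generalizing p r with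
  | zero => simp
  | succ M ih =>
    rw [sum_fin_succ]
    have key : ∀ z, ∑ x : Fin M → α, seqLaw p (Fin.cons z x : Fin (M + 1) → α) *
        ∑ t : Fin (M + 1), r ((List.ofFn (Fin.cons z x : Fin (M + 1) → α)).take t)
          ((Fin.cons z x : Fin (M + 1) → α) t) ≤ p [] z * r [] z + p [] z * (M * C) := by
      intro z
      have h1 := ih (p := fun h => p (z :: h)) (r := fun h => r (z :: h))
        (fun h => hp0 (z :: h)) (fun h => hp (z :: h)) (fun h => hr (z :: h))
      have h2 := sum_seqLaw (p := fun h => p (z :: h)) (fun h => hp (z :: h)) M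
      calc _ = p [] z * (r [] z * ∑ x : Fin M → α, seqLaw (fun h => p (z :: h)) x +
            ∑ x : Fin M → α, seqLaw (fun h => p (z :: h)) x *
              ∑ t : Fin M, r (z :: (List.ofFn x).take t) (x t)) := by
            rw [Finset.mul_sum, ← Finset.sum_add_distrib, Finset.mul_sum]
            refine Finset.sum_congr rfl fun x _ => ?_
            simp only [seqLaw_cons, Fin.sum_univ_succ, List.ofFn_cons, Fin.val_zero,
              List.take_zero, Fin.cons_zero, Fin.val_succ, List.take_succ_cons, Fin.cons_succ]
            ring
        _ ≤ p [] z * (r [] z + M * C) := by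
            rw [h2, mul_one]
            exact mul_le_mul_of_nonneg_left (by linarith) (hp0 _ _)
        _ = _ := mul_add _ _ _
    refine (Finset.sum_le_sum fun z _ => key z).trans ?_
    rw [Finset.sum_add_distrib, ← Finset.sum_mul, hp, one_mul]
    push_cast
    linarith [hr []]

/-! ### Hellinger distance of adaptive measurement records -/

theorem exp_le_one_add {u : ℝ} (hu : |u| ≤ 1 / 2) : Real.exp (u - 2 * u ^ 2) ≤ 1 + u := by
  obtain ⟨h1, h2⟩ := abs_le.mp hu
  have hpos : 0 < 1 + u := by linarith
  rw [← Real.le_log_iff_exp_le hpos]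
  refine le_trans ?_ (Real.one_sub_inv_le_log_of_pos hpos)
  rw [← sub_nonneg, show 1 - (1 + u)⁻¹ - (u - 2 * u ^ 2) = u ^ 2 * (1 + 2 * u) / (1 + u) by
    field_simp; ring]
  exact div_nonneg (mul_nonneg (sq_nonneg _) (by linarith)) hpos.le

/-- A lower bound on the Bhattacharyya coefficient that is additive over the steps. It holds
pointwise, because `√(1 + u) ≥ exp ((u - 2 u²) / 2)`. -/
theorem seqLaw_mul_le_sqrt {p s : List α → α → ℝ} (hp : ∀ h z, 0 ≤ p h z) {δ : ℝ}
    (hs : ∀ h z, |δ * s h z| ≤ 1 / 2) {M : ℕ} (x : Fin M → α) :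
    seqLaw p x * (1 + ∑ t : Fin M, (δ * s ((List.ofFn x).take t) (x t) -
      2 * (δ * s ((List.ofFn x).take t) (x t)) ^ 2) / 2) ≤
      √(seqLaw p x) * √(seqLaw (fun h z => p h z * (1 + δ * s h z)) x) := by
  have h0 := seqLaw_nonneg hp x
  have h1 : seqLaw (fun h z => p h z * (1 + δ * s h z)) x = seqLaw p x *
      ∏ t : Fin M, (1 + δ * s ((List.ofFn x).take t) (x t)) := Finset.prod_mul_distrib
  rw [h1, Real.sqrt_mul h0, ← mul_assoc, Real.mul_self_sqrt h0]
  refine mul_le_mul_of_nonneg_left ?_ h0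
  have h2 : Real.exp (∑ t : Fin M, (δ * s ((List.ofFn x).take t) (x t) -
      2 * (δ * s ((List.ofFn x).take t) (x t)) ^ 2)) ≤
      ∏ t : Fin M, (1 + δ * s ((List.ofFn x).take t) (x t)) := by
    rw [Real.exp_sum]
    exact Finset.prod_le_prod (fun _ _ => (Real.exp_pos _).le) fun t _ => exp_le_one_add (hs _ _)
  refine le_trans ?_ (Real.sqrt_le_sqrt h2)
  rw [← Finset.sum_div, ← Real.exp_half, add_comm]
  exact Real.add_one_le_exp _

theorem abs_sub_le_hellinger {a b l : ℝ} (ha : 0 ≤ a) (hb : 0 ≤ b) (hl : 0 < l) :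
    |a - b| ≤ (a + b - 2 * (√a * √b)) / (2 * l) + l * (a + b) := by
  have ha' := Real.sq_sqrt ha
  have hb' := Real.sq_sqrt hb
  set x := √a with hx
  set y := √b with hy
  have hx0 : 0 ≤ x := Real.sqrt_nonneg _
  have hy0 : 0 ≤ y := Real.sqrt_nonneg _
  rw [← ha', ← hb', show x ^ 2 - y ^ 2 = (x - y) * (x + y) by ring, abs_mul,
    abs_of_nonneg (add_nonneg hx0 hy0),
    show x ^ 2 + y ^ 2 - 2 * (x * y) = |x - y| ^ 2 by rw [sq_abs]; ring]
  have h1 : |x - y| * (x + y) ≤ |x - y| ^ 2 / (2 * l) + l / 2 * (x + y) ^ 2 := by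
    rw [← sub_nonneg, show |x - y| ^ 2 / (2 * l) + l / 2 * (x + y) ^ 2 - |x - y| * (x + y) =
      (|x - y| - l * (x + y)) ^ 2 / (2 * l) by field_simp; ring]
    positivity
  have h2 : l / 2 * (x + y) ^ 2 ≤ l * (x ^ 2 + y ^ 2) := by nlinarith [sq_nonneg (x - y)]
  linarith

/-- The total variation distance between two adaptive measurement records, bounded by the expected
sum of the one-step contributions to the squared Hellinger distance; `l` is the free parameter of
the inequality between arithmetic and geometric means. -/
theorem sum_abs_seqLaw_sub_le [Fintype α] {p s : List α → α → ℝ} (hp0 : ∀ h z, 0 ≤ p h z)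
    (hp : ∀ h, ∑ z, p h z = 1) {δ : ℝ} (hs : ∀ h z, |δ * s h z| ≤ 1 / 2)
    (hps : ∀ h, ∑ z, p h z * s h z = 0) {l : ℝ} (hl : 0 < l) (M : ℕ) :
    ∑ x : Fin M → α, |seqLaw p x - seqLaw (fun h z => p h z * (1 + δ * s h z)) x| ≤
      (∑ x : Fin M → α, seqLaw p x * ∑ t : Fin M, (2 * (δ * s ((List.ofFn x).take t) (x t)) ^ 2 -
        δ * s ((List.ofFn x).take t) (x t))) / (2 * l) + 2 * l := by
  have hq0 : ∀ h z, 0 ≤ p h z * (1 + δ * s h z) := fun h z =>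
    mul_nonneg (hp0 h z) (by linarith [(abs_le.mp (hs h z)).1])
  have hq : ∀ h, ∑ z, p h z * (1 + δ * s h z) = 1 := fun h => by
    have h1 : ∀ z, p h z * (1 + δ * s h z) = p h z + δ * (p h z * s h z) := fun z => by ring
    simp only [h1]
    rw [Finset.sum_add_distrib, ← Finset.mul_sum, hp, hps, mul_zero, add_zero]
  calc _ ≤ ∑ x : Fin M → α, ((seqLaw p x + seqLaw (fun h z => p h z * (1 + δ * s h z)) x -
          2 * (√(seqLaw p x) * √(seqLaw (fun h z => p h z * (1 + δ * s h z)) x))) / (2 * l) +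
          l * (seqLaw p x + seqLaw (fun h z => p h z * (1 + δ * s h z)) x)) :=
        Finset.sum_le_sum fun x _ =>
          abs_sub_le_hellinger (seqLaw_nonneg hp0 x) (seqLaw_nonneg hq0 x) hl
    _ ≤ ∑ x : Fin M → α, ((seqLaw (fun h z => p h z * (1 + δ * s h z)) x - seqLaw p x +
          seqLaw p x * ∑ t : Fin M, (2 * (δ * s ((List.ofFn x).take t) (x t)) ^ 2 -
            δ * s ((List.ofFn x).take t) (x t))) / (2 * l) +
          l * (seqLaw p x + seqLaw (fun h z => p h z * (1 + δ * s h z)) x)) := by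
        refine Finset.sum_le_sum fun x _ => ?_
        gcongr ?_ / _ + _
        have h1 := seqLaw_mul_le_sqrt hp0 hs x
        have h2 : ∑ t : Fin M, (2 * (δ * s ((List.ofFn x).take t) (x t)) ^ 2 -
            δ * s ((List.ofFn x).take t) (x t)) = -2 * ∑ t : Fin M,
            (δ * s ((List.ofFn x).take t) (x t) -
              2 * (δ * s ((List.ofFn x).take t) (x t)) ^ 2) / 2 := by
          rw [Finset.mul_sum]
          exact Finset.sum_congr rfl fun t _ => by ring
        rw [h2]
        linarith
    _ = _ := by
        rw [Finset.sum_add_distrib, ← Finset.sum_div, ← Finset.mul_sum, Finset.sum_add_distrib,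
          Finset.sum_sub_distrib, Finset.sum_add_distrib, sum_seqLaw hp, sum_seqLaw hq]
        ring

/-- Testing one null hypothesis `p` against many alternatives `p (1 + δ s_i)` with adaptive
measurements. If every single measurement is sensitive to at most `m` of the alternatives, then
correct decisions `E₀ i` and `E₁ i` with high probability need many measurements. -/
theorem sum_success_le [Fintype α] {ι : Type} [Fintype ι] {p : List α → α → ℝ} {s : ι → List α → α → ℝ}
    (hp0 : ∀ h z, 0 ≤ p h z) (hp : ∀ h, ∑ z, p h z = 1) {δ : ℝ} (hδ : |δ| ≤ 1 / 2)
    (hs : ∀ i h z, |s i h z| ≤ 1) (hps : ∀ i h, ∑ z, p h z * s i h z = 0) {m : ℝ}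
    (hm : ∀ h z, ∑ i, s i h z ^ 2 ≤ m) {l : ℝ} (hl : 0 < l) (M : ℕ)
    {E₀ E₁ : ι → (Fin M → α) → ℝ} (h0 : ∀ i x, 0 ≤ E₀ i x) (h1 : ∀ i x, 0 ≤ E₁ i x)
    (h01 : ∀ i x, E₀ i x + E₁ i x ≤ 1) :
    ∑ i, (∑ x, seqLaw p x * E₀ i x +
      ∑ x, seqLaw (fun h z => p h z * (1 + δ * s i h z)) x * E₁ i x) ≤
      Fintype.card ι * (1 + 2 * l) + δ ^ 2 * (M * m) / l := by
  have hs' : ∀ i h z, |δ * s i h z| ≤ 1 / 2 := fun i h z => by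
    rw [abs_mul]
    nlinarith [hs i h z, abs_nonneg (s i h z), abs_nonneg δ]
  have hstep : ∀ i, ∑ x, seqLaw p x * E₀ i x +
      ∑ x, seqLaw (fun h z => p h z * (1 + δ * s i h z)) x * E₁ i x ≤
      1 + 2 * l + (∑ x : Fin M → α, seqLaw p x * ∑ t : Fin M,
        (2 * (δ * s i ((List.ofFn x).take t) (x t)) ^ 2 -
          δ * s i ((List.ofFn x).take t) (x t))) / (2 * l) := by
    intro i
    have hTV := sum_abs_seqLaw_sub_le hp0 hp (hs' i) (hps i) hl M
    have : ∑ x, (seqLaw p x * E₀ i x +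
        seqLaw (fun h z => p h z * (1 + δ * s i h z)) x * E₁ i x) ≤
        ∑ x : Fin M → α, (seqLaw p x + |seqLaw p x - seqLaw (fun h z => p h z * (1 + δ * s i h z)) x|) := by
      refine Finset.sum_le_sum fun x _ => ?_
      have hx := seqLaw_nonneg hp0 x
      set P := seqLaw p x
      set R := seqLaw (fun h z => p h z * (1 + δ * s i h z)) x
      have ha := neg_abs_le (P - R)
      have hE1 : E₁ i x ≤ 1 := by linarith [h01 i x, h0 i x]
      nlinarith [h01 i x, h0 i x, h1 i x, abs_nonneg (P - R)]
    rw [Finset.sum_add_distrib, Finset.sum_add_distrib, sum_seqLaw hp] at this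
    linarith
  refine (Finset.sum_le_sum fun i _ => hstep i).trans ?_
  rw [Finset.sum_add_distrib, Finset.sum_const, Finset.card_univ, nsmul_eq_mul, ← Finset.sum_div,
    Finset.sum_comm]
  have hreward := sum_seqLaw_mul_sum_le (r := fun h z => ∑ i, (2 * (δ * s i h z) ^ 2 - δ * s i h z))
    (C := 2 * δ ^ 2 * m) hp0 hp ?_ M
  · have hcomm : ∑ x : Fin M → α, ∑ i, seqLaw p x * ∑ t : Fin M,
        (2 * (δ * s i ((List.ofFn x).take t) (x t)) ^ 2 - δ * s i ((List.ofFn x).take t) (x t)) =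
        ∑ x : Fin M → α, seqLaw p x * ∑ t : Fin M, ∑ i,
          (2 * (δ * s i ((List.ofFn x).take t) (x t)) ^ 2 -
            δ * s i ((List.ofFn x).take t) (x t)) := by
      refine Finset.sum_congr rfl fun x _ => ?_
      rw [← Finset.mul_sum, Finset.sum_comm]
    rw [hcomm]
    have : δ ^ 2 * (M * m) / l = (M * (2 * δ ^ 2 * m)) / (2 * l) := by field_simp
    rw [this]
    gcongr
  · intro h
    have hlin : ∑ z, p h z * ∑ i, δ * s i h z = 0 := by
      simp only [Finset.mul_sum]
      rw [Finset.sum_comm]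
      refine Finset.sum_eq_zero fun i _ => ?_
      calc ∑ z, p h z * (δ * s i h z) = δ * ∑ z, p h z * s i h z := by
            rw [Finset.mul_sum]
            exact Finset.sum_congr rfl fun z _ => by ring
        _ = 0 := by rw [hps, mul_zero]
    calc ∑ z, p h z * ∑ i, (2 * (δ * s i h z) ^ 2 - δ * s i h z)
        = ∑ z, p h z * (2 * δ ^ 2 * ∑ i, s i h z ^ 2) - ∑ z, p h z * ∑ i, δ * s i h z := by
          rw [← Finset.sum_sub_distrib]
          refine Finset.sum_congr rfl fun z _ => ?_
          rw [Finset.sum_sub_distrib, mul_sub, Finset.mul_sum _ _ (2 * δ ^ 2)]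
          congr 2
          exact Finset.sum_congr rfl fun i _ => by ring
      _ ≤ ∑ z, p h z * (2 * δ ^ 2 * m) := by
          rw [hlin, sub_zero]
          refine Finset.sum_le_sum fun z _ => mul_le_mul_of_nonneg_left ?_ (hp0 h z)
          exact mul_le_mul_of_nonneg_left (hm h z) (by positivity)
      _ = 2 * δ ^ 2 * m := by rw [← Finset.sum_mul, hp, one_mul]

end SeqLaw

/-! ### Readout statistics of a protocol -/

section Protocol

variable {N M k : ℕ} {ι : Type}

theorem DetProtocol.law_eq_seqLaw (D : DetProtocol N M ι) (ρ : Operator (Fin N))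
    (x : Fin M → Outcome N D.ancillas) :
    D.law ρ x = seqLaw (fun h z => (D.circuit h).prob ρ z) x := rfl

theorem DetProtocol.law_nonneg (D : DetProtocol N M ι) {ρ : Operator (Fin N)}
    (hρ : IsFermionState ρ) (x : Fin M → Outcome N D.ancillas) : 0 ≤ D.law ρ x :=
  seqLaw_nonneg (fun h z => (D.circuit h).prob_nonneg hρ.posSemidef z) x

theorem DetProtocol.sum_law (D : DetProtocol N M ι) {ρ : Operator (Fin N)}
    (hρ : IsFermionState ρ) : ∑ x, D.law ρ x = 1 :=
  sum_seqLaw (p := fun h z => (D.circuit h).prob ρ z)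
    (fun h => by rw [(D.circuit h).sum_prob, hρ.trace_eq_one, Complex.one_re]) M

variable (A : Protocol N M ι)

theorem Protocol.mean_const {ρ : Operator (Fin N)} (hρ : IsFermionState ρ) (c : ℝ≥0∞) :
    A.mean ρ (fun _ _ => c) = c := by
  have h : ∀ D : DetProtocol N M ι, ∑ x, ENNReal.ofReal (D.law ρ x) * c = c := fun D => by
    rw [← Finset.sum_mul, ← ENNReal.ofReal_sum_of_nonneg fun x _ => D.law_nonneg hρ x,
      D.sum_law hρ, ENNReal.ofReal_one, one_mul]
  simp only [Protocol.mean, h]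
  rw [ENNReal.tsum_mul_right, A.tsum_coe, one_mul]

theorem Protocol.mean_mono {ρ : Operator (Fin N)}
    {f g : (D : DetProtocol N M ι) → (Fin M → Outcome N D.ancillas) → ℝ≥0∞}
    (h : ∀ D x, f D x ≤ g D x) : A.mean ρ f ≤ A.mean ρ g :=
  ENNReal.tsum_le_tsum fun D => mul_le_mul_right (Finset.sum_le_sum fun x _ =>
    mul_le_mul_right (h D x) _) _

theorem Protocol.mean_add (ρ : Operator (Fin N))
    (f g : (D : DetProtocol N M ι) → (Fin M → Outcome N D.ancillas) → ℝ≥0∞) :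
    A.mean ρ (fun D x => f D x + g D x) = A.mean ρ f + A.mean ρ g := by
  simp only [Protocol.mean, mul_add, Finset.sum_add_distrib]
  exact ENNReal.tsum_add

theorem Protocol.mean_const_mul (ρ : Operator (Fin N)) (c : ℝ≥0∞)
    (f : (D : DetProtocol N M ι) → (Fin M → Outcome N D.ancillas) → ℝ≥0∞) :
    A.mean ρ (fun D x => c * f D x) = c * A.mean ρ f := by
  simp only [Protocol.mean, mul_left_comm _ c, ← Finset.mul_sum]
  exact ENNReal.tsum_mul_left

/-- Chebyshev's inequality turns the root-mean-square criterion into the probabilistic one. -/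
theorem Protocol.AccurateInRMS.accurateWithProb {A : Protocol N M ι} {O : ι → Operator (Fin N)}
    {ε : ℝ} (hε : 0 < ε) (h : A.AccurateInRMS O ε) : A.AccurateWithProb O (2 * ε) (3 / 4) := by
  classical
  intro ρ hρ e
  have hc : 0 < 4 * ε ^ 2 := by positivity
  have h1 : A.mean ρ (fun _ _ => 1) ≤ A.mean ρ (fun D x =>
      (if ‖D.estimate x e - expectation ρ (O e)‖ ≤ 2 * ε then 1 else 0) +
        ENNReal.ofReal (4 * ε ^ 2)⁻¹ *
          ENNReal.ofReal (‖D.estimate x e - expectation ρ (O e)‖ ^ 2)) := by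
    refine A.mean_mono fun D x => ?_
    split_ifs with hx
    · exact le_self_add
    · rw [zero_add, ← ENNReal.ofReal_mul (by positivity), ENNReal.one_le_ofReal,
        inv_mul_eq_div, one_le_div hc]
      nlinarith
  rw [A.mean_const hρ, A.mean_add, A.mean_const_mul] at h1
  have h2 : ENNReal.ofReal (4 * ε ^ 2)⁻¹ * A.mean ρ (fun D x =>
      ENNReal.ofReal (‖D.estimate x e - expectation ρ (O e)‖ ^ 2)) ≤ ENNReal.ofReal (1 / 4) := by
    refine (mul_le_mul_right (h ρ hρ e) _).trans (le_of_eq ?_)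
    rw [← ENNReal.ofReal_mul (by positivity)]
    congr 1
    field_simp
  have h3 : ENNReal.ofReal (3 / 4) + ENNReal.ofReal (1 / 4) = 1 := by
    rw [← ENNReal.ofReal_add (by norm_num) (by norm_num)]
    norm_num
  refine (ENNReal.add_le_add_iff_right (ENNReal.ofReal_ne_top (r := 1 / 4))).mp
    ((h3.le.trans h1).trans ?_)
  exact add_le_add le_rfl h2

/-! ### Lower bound on the number of preparations -/

theorem abs_prob_majoranaOp_le {a : ℕ} (hk : 1 ≤ k) (U : CliffordCircuit N a)
    (T : MajoranaIndex N k) (z : Outcome N a) :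
    |((2 : ℝ) ^ N)⁻¹ * U.prob (majoranaOp T) z| ≤ ((2 : ℝ) ^ N)⁻¹ * U.prob 1 z := by
  have h : ∀ δ : ℝ, |δ| ≤ 1 → 0 ≤ ((2 : ℝ) ^ N)⁻¹ * U.prob 1 z +
      δ * (((2 : ℝ) ^ N)⁻¹ * U.prob (majoranaOp T) z) := fun δ hδ => by
    rw [← prob_majoranaState]
    exact U.prob_nonneg (isFermionState_majoranaState hk T hδ).posSemidef z
  exact abs_le.mpr ⟨by linarith [h 1 (by simp)], by linarith [h (-1) (by simp)]⟩

/-- Distinguishing the maximally mixed state from all the states `(1 + δ G_T) / 2 ^ N`: a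
single circuit is sensitive only to the at most `(2 N) ^ k` operators `G_T` in its clique. -/
theorem DetProtocol.sum_success_le (D : DetProtocol N M ι) (hk : 1 ≤ k) {δ : ℝ} (hδ : |δ| ≤ 1 / 2)
    {l : ℝ} (hl : 0 < l) {E₀ E₁ : MajoranaIndex N k → (Fin M → Outcome N D.ancillas) → ℝ}
    (h0 : ∀ T x, 0 ≤ E₀ T x) (h1 : ∀ T x, 0 ≤ E₁ T x) (h01 : ∀ T x, E₀ T x + E₁ T x ≤ 1) :
    ∑ T : MajoranaIndex N k, (∑ x, D.law (majoranaState T 0) x * E₀ T x +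
      ∑ x, D.law (majoranaState T δ) x * E₁ T x) ≤
      (2 * N).choose (2 * k) * (1 + 2 * l) + δ ^ 2 * (M * (2 * N) ^ k) / l := by
  set p : List (Outcome N D.ancillas) → Outcome N D.ancillas → ℝ := fun h z =>
    ((2 : ℝ) ^ N)⁻¹ * (D.circuit h).prob 1 z with hp
  set s : MajoranaIndex N k → List (Outcome N D.ancillas) → Outcome N D.ancillas → ℝ :=
    fun T h z => ((2 : ℝ) ^ N)⁻¹ * (D.circuit h).prob (majoranaOp T) z / p h z with hs
  have hbound : ∀ T h z, |((2 : ℝ) ^ N)⁻¹ * (D.circuit h).prob (majoranaOp T) z| ≤ p h z :=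
    fun T h z => abs_prob_majoranaOp_le hk (D.circuit h) T z
  have hp0 : ∀ h z, 0 ≤ p h z := fun h z =>
    mul_nonneg (by positivity) ((D.circuit h).prob_nonneg Matrix.PosSemidef.one z)
  -- Where `p h z` vanishes, so does the numerator of `s T h z`.
  have hps : ∀ T h z, p h z * s T h z = ((2 : ℝ) ^ N)⁻¹ * (D.circuit h).prob (majoranaOp T) z := by
    intro T h z
    rcases (hp0 h z).eq_or_lt with h0 | h0
    · have := hbound T h z
      rw [← h0] at this
      rw [← h0, zero_mul, abs_nonpos_iff.mp this]
    · exact mul_div_cancel₀ _ h0.ne'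
  have hs1 : ∀ T h z, |s T h z| ≤ 1 := fun T h z => by
    rw [hs, abs_div, abs_of_nonneg (hp0 h z)]
    exact div_le_one_of_le₀ (hbound T h z) (hp0 h z)
  have hlaw : ∀ T δ x, D.law (majoranaState T δ) x =
      seqLaw (fun h z => p h z * (1 + δ * s T h z)) x := by
    intro T δ x
    rw [D.law_eq_seqLaw]
    congr 1
    funext h z
    rw [prob_majoranaState, ← hps, hp]
    ring
  have hlaw0 : ∀ T x, D.law (majoranaState T 0) x = seqLaw p x := fun T x => by
    rw [hlaw]
    simp only [zero_mul, add_zero, mul_one]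
  rw [Finset.sum_congr rfl fun T _ => congrArg₂ (· + ·)
    (Finset.sum_congr rfl fun x _ => by rw [hlaw0 T x])
    (Finset.sum_congr rfl fun x _ => by rw [hlaw T δ x]), ← card_majoranaIndex]
  refine FermionTomography.sum_success_le hp0 (fun h => ?_) hδ hs1 (fun T h => ?_) (fun h z => ?_)
    hl M h0 h1 h01
  · rw [hp, ← Finset.mul_sum, CliffordCircuit.sum_prob, Matrix.trace_one, Complex.natCast_re]
    simp
  · simp only [hps]
    rw [← Finset.mul_sum, CliffordCircuit.sum_prob, trace_majoranaOp hk]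
    simp
  · have hterm : ∀ T, s T h z ^ 2 ≤ if T ∈ majoranaLabels k ((D.circuit h).clique k) then 1
        else 0 := by
      intro T
      split_ifs with hT
      · exact (sq_le_one_iff_abs_le_one _).mpr (hs1 T h z)
      · rw [mem_majoranaLabels] at hT
        simp [hs, (D.circuit h).prob_majoranaOp_eq_zero hT z]
    refine (Finset.sum_le_sum fun T _ => hterm T).trans ?_
    rw [Finset.sum_boole, Finset.filter_mem_eq_inter, Finset.univ_inter]
    exact_mod_cast card_majoranaLabels_le_pow ((D.circuit h).clique_pairwise_commute k)

theorem Protocol.mean_ite_eq (ρ : Operator (Fin N)) (hρ : IsFermionState ρ)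
    (P : (D : DetProtocol N M ι) → (Fin M → Outcome N D.ancillas) → Prop)
    [∀ D x, Decidable (P D x)] :
    A.mean ρ (fun D x => if P D x then 1 else 0) =
      ∑' D, A D * ENNReal.ofReal (∑ x, D.law ρ x * if P D x then 1 else 0) := by
  refine tsum_congr fun D => ?_
  rw [ENNReal.ofReal_sum_of_nonneg fun x _ =>
    mul_nonneg (D.law_nonneg hρ x) (by split_ifs <;> norm_num)]
  congr 1
  refine Finset.sum_congr rfl fun x _ => ?_
  by_cases h : P D x <;> simp [h]

/-- The success probabilities of a protocol against all the test states, averaged over its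
classical randomness. -/
theorem Protocol.AccurateWithProb.success_bound {A : Protocol N M ι} {O : ι → Operator (Fin N)}
    {ε p : ℝ} (h : A.AccurateWithProb O ε p) (hk : 1 ≤ k) {δ : ℝ} (hδ : |δ| ≤ 1 / 2)
    {l : ℝ} (hl : 0 < l) (hp : 0 ≤ p) (label : MajoranaIndex N k → ι)
    (hsep : ∀ T : MajoranaIndex N k,
      2 * ε < |δ| * ‖(majoranaOp T * O (label T)).trace / 2 ^ N‖) :
    (2 * N).choose (2 * k) * (2 * p) ≤
      (2 * N).choose (2 * k) * (1 + 2 * l) + δ ^ 2 * (M * (2 * N) ^ k) / l := by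
  classical
  set B : ℝ := (2 * N).choose (2 * k) * (1 + 2 * l) + δ ^ 2 * (M * (2 * N) ^ k) / l with hB
  have hB0 : 0 ≤ B := by positivity
  have hst : ∀ (T : MajoranaIndex N k), IsFermionState (majoranaState T 0) ∧
      IsFermionState (majoranaState T δ) := fun T =>
    ⟨isFermionState_majoranaState hk T (by simp),
      isFermionState_majoranaState hk T (hδ.trans (by norm_num))⟩
  set S : ℝ → MajoranaIndex N k → (D : DetProtocol N M ι) → (Fin M → Outcome N D.ancillas) → ℝ :=
    fun δ T D x => if ‖D.estimate x (label T) - expectation (majoranaState T δ) (O (label T))‖ ≤ ε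
      then 1 else 0 with hS
  have hS0 : ∀ δ T D x, 0 ≤ S δ T D x := fun δ T D x => by
    simp only [hS]
    split_ifs <;> norm_num
  -- The two expectation values are more than `2 ε` apart, so that no estimate fits both.
  have hS1 : ∀ T D x, S 0 T D x + S δ T D x ≤ 1 := by
    intro T D x
    simp only [hS]
    split_ifs with h1 h2
    · exfalso
      have h3 := norm_sub_le (D.estimate x (label T) - expectation (majoranaState T 0) (O (label T)))
        (D.estimate x (label T) - expectation (majoranaState T δ) (O (label T)))
      have h4 : ‖expectation (majoranaState T δ) (O (label T)) -
          expectation (majoranaState T 0) (O (label T))‖ =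
          |δ| * ‖(majoranaOp T * O (label T)).trace / 2 ^ N‖ := by
        rw [expectation_majoranaState, expectation_majoranaState, add_sub_add_left_eq_sub,
          Complex.ofReal_zero, zero_mul, sub_zero, norm_mul, Complex.norm_real, Real.norm_eq_abs]
      rw [sub_sub_sub_cancel_left, h4] at h3
      linarith [hsep T]
    all_goals norm_num
  have hmean : ∀ δ T, IsFermionState (majoranaState T δ) → ENNReal.ofReal p ≤
      ∑' D, A D * ENNReal.ofReal (∑ x, D.law (majoranaState T δ) x * S δ T D x) := by
    intro δ T hT
    refine (h _ hT (label T)).trans (le_of_eq ?_)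
    rw [A.mean_ite_eq _ hT]
  have hsum : ∑ T : MajoranaIndex N k, (ENNReal.ofReal p + ENNReal.ofReal p) ≤
      ∑' D, A D * ENNReal.ofReal B := by
    calc _ ≤ ∑ T : MajoranaIndex N k, ∑' D, A D *
          ENNReal.ofReal (∑ x, D.law (majoranaState T 0) x * S 0 T D x +
            ∑ x, D.law (majoranaState T δ) x * S δ T D x) := by
          refine Finset.sum_le_sum fun T _ => ?_
          refine (add_le_add (hmean 0 T (hst T).1) (hmean δ T (hst T).2)).trans (le_of_eq ?_)
          rw [← ENNReal.tsum_add]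
          refine tsum_congr fun D => ?_
          rw [← mul_add, ENNReal.ofReal_add]
          · exact Finset.sum_nonneg fun x _ => mul_nonneg (D.law_nonneg (hst T).1 x) (hS0 _ _ _ _)
          · exact Finset.sum_nonneg fun x _ => mul_nonneg (D.law_nonneg (hst T).2 x) (hS0 _ _ _ _)
      _ = ∑' D, ∑ T : MajoranaIndex N k, A D *
          ENNReal.ofReal (∑ x, D.law (majoranaState T 0) x * S 0 T D x +
            ∑ x, D.law (majoranaState T δ) x * S δ T D x) :=
          (Summable.tsum_finsetSum fun _ _ => ENNReal.summable).symm
      _ ≤ _ := by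
          refine ENNReal.tsum_le_tsum fun D => ?_
          rw [← Finset.mul_sum, ← ENNReal.ofReal_sum_of_nonneg]
          · exact mul_le_mul_right (ENNReal.ofReal_le_ofReal (D.sum_success_le hk hδ hl
              (fun T x => hS0 0 T D x) (fun T x => hS0 δ T D x) fun T x => hS1 T D x)) _
          · exact fun T _ => add_nonneg
              (Finset.sum_nonneg fun x _ => mul_nonneg (D.law_nonneg (hst T).1 x) (hS0 _ _ _ _))
              (Finset.sum_nonneg fun x _ => mul_nonneg (D.law_nonneg (hst T).2 x) (hS0 _ _ _ _))
  rw [ENNReal.tsum_mul_right, A.tsum_coe, one_mul, ← ENNReal.ofReal_add hp hp,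
    ← ENNReal.ofReal_sum_of_nonneg fun _ _ => by positivity, ENNReal.ofReal_le_ofReal_iff hB0,
    Finset.sum_const, Finset.card_univ, card_majoranaIndex, nsmul_eq_mul] at hsum
  linarith

/-- There are of order `N ^ (2 k)` Majorana operators of degree `2 k`. -/
theorem pow_le_mul_choose (hk : 1 ≤ k) (hN : k ≤ N) :
    (N : ℝ) ^ (2 * k) ≤ k ^ (2 * k) * (2 * k).factorial * (2 * N).choose (2 * k) := by
  have h1 : N ≤ k * (2 * N + 1 - 2 * k) := by
    obtain ⟨d, rfl⟩ := Nat.exists_eq_add_of_le hN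
    rw [show 2 * (k + d) + 1 - 2 * k = 2 * d + 1 by omega]
    nlinarith
  have h2 := Nat.pow_le_choose (α := ℝ) (2 * k) (2 * N)
  rw [div_le_iff₀ (by positivity)] at h2
  calc (N : ℝ) ^ (2 * k) ≤ ((k : ℝ) * (2 * N + 1 - 2 * k : ℕ)) ^ (2 * k) := by
        gcongr
        exact_mod_cast h1
    _ = (k : ℝ) ^ (2 * k) * ((2 * N + 1 - 2 * k : ℕ) : ℝ) ^ (2 * k) := mul_pow _ _ _
    _ ≤ (k : ℝ) ^ (2 * k) * ((2 * N).choose (2 * k) * (2 * k).factorial) := by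
        gcongr
    _ = _ := by ring

/-- The constant in the lower bound on the number of preparations. -/
noncomputable def preparationConstant (k : ℕ) (p : ℝ) : ℝ :=
  (2 * p - 1) ^ 2 * (1 / 16) ^ k / (72 * 2 ^ k * (k ^ (2 * k) * (2 * k).factorial))

theorem preparationConstant_pos (hk : 1 ≤ k) {p : ℝ} (hp : 1 / 2 < p) :
    0 < preparationConstant k p := by
  have h1 : 0 < 2 * p - 1 := by linarith
  have h2 : (0 : ℝ) < k := by exact_mod_cast hk
  unfold preparationConstant
  positivity

theorem Protocol.AccurateWithProb.preparations_ge {A : Protocol N M ι} {O : ι → Operator (Fin N)}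
    {ε p : ℝ} (h : A.AccurateWithProb O ε p) (hk : 1 ≤ k) (hN : k ≤ N) (hp : 1 / 2 < p)
    (hε : 0 < ε) (hε' : ε ≤ (1 / 4) ^ k / 6) (label : MajoranaIndex N k → ι)
    (hlabel : ∀ T : MajoranaIndex N k,
      (1 / 4) ^ k ≤ ‖(majoranaOp T * O (label T)).trace / 2 ^ N‖) :
    preparationConstant k p * (ε⁻¹ ^ 2 * (N : ℝ) ^ k) ≤ M := by
  have hη : 0 < 2 * p - 1 := by linarith
  have hκ : (0 : ℝ) < (1 / 4) ^ k := by positivity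
  -- This `δ` moves the expectation values by at least `3 ε`.
  set δ : ℝ := 3 * ε / (1 / 4) ^ k with hδ
  have hδ0 : 0 < δ := by positivity
  have hδκ : δ * (1 / 4) ^ k = 3 * ε := div_mul_cancel₀ _ hκ.ne'
  have hδ1 : |δ| ≤ 1 / 2 := by
    rw [abs_of_pos hδ0, hδ, div_le_iff₀ hκ]
    linarith
  have hb := h.success_bound hk hδ1 (l := (2 * p - 1) / 4) (by linarith) (by linarith) label
    fun T => by
      rw [abs_of_pos hδ0]
      have := mul_le_mul_of_nonneg_left (hlabel T) hδ0.le
      linarith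
  have hc := pow_le_mul_choose hk hN
  set n : ℝ := (((2 * N).choose (2 * k) : ℕ) : ℝ)
  have h1 : (2 * p - 1) ^ 2 * n ≤ 8 * δ ^ 2 * (M * (2 * N) ^ k) := by
    have h2 : n * (2 * p - 1) / 2 ≤ δ ^ 2 * (M * (2 * N) ^ k) / ((2 * p - 1) / 4) := by linarith
    rw [le_div_iff₀ (by linarith)] at h2
    linarith
  have hN0 : (0 : ℝ) < N := by exact_mod_cast lt_of_lt_of_le hk hN
  have hk0 : (0 : ℝ) < k := by exact_mod_cast hk
  set K : ℝ := k ^ (2 * k) * (2 * k).factorial with hK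
  have hK0 : 0 < K := by positivity
  have h3 : (2 * p - 1) ^ 2 * (N : ℝ) ^ (2 * k) ≤ K * (8 * δ ^ 2 * (M * (2 * N) ^ k)) :=
    calc _ ≤ (2 * p - 1) ^ 2 * (K * n) := mul_le_mul_of_nonneg_left hc (sq_nonneg _)
      _ = K * ((2 * p - 1) ^ 2 * n) := by ring
      _ ≤ _ := mul_le_mul_of_nonneg_left h1 hK0.le
  have h4 : (2 * p - 1) ^ 2 * (N : ℝ) ^ k ≤ K * (8 * δ ^ 2 * (M * 2 ^ k)) := by
    refine le_of_mul_le_mul_right (a := (N : ℝ) ^ k) ?_ (by positivity)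
    calc _ = (2 * p - 1) ^ 2 * (N : ℝ) ^ (2 * k) := by ring
      _ ≤ _ := h3
      _ = _ := by rw [mul_pow]; ring
  have h16 : ((1 : ℝ) / 16) ^ k = ((1 / 4) ^ k) ^ 2 := by
    rw [← pow_mul, mul_comm, pow_mul]
    norm_num
  have h5 : (2 * p - 1) ^ 2 * (1 / 16) ^ k * (N : ℝ) ^ k ≤ 72 * 2 ^ k * K * ε ^ 2 * M :=
    calc _ = (2 * p - 1) ^ 2 * (N : ℝ) ^ k * ((1 / 4) ^ k) ^ 2 := by rw [h16]; ring
      _ ≤ K * (8 * δ ^ 2 * (M * 2 ^ k)) * ((1 / 4) ^ k) ^ 2 :=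
          mul_le_mul_of_nonneg_right h4 (sq_nonneg _)
      _ = K * 8 * M * 2 ^ k * (δ * (1 / 4) ^ k) ^ 2 := by ring
      _ = _ := by rw [hδκ]; ring
  rw [preparationConstant, ← hK, show (2 * p - 1) ^ 2 * (1 / 16) ^ k / (72 * 2 ^ k * K) *
    (ε⁻¹ ^ 2 * (N : ℝ) ^ k) = (2 * p - 1) ^ 2 * (1 / 16) ^ k * (N : ℝ) ^ k /
      (72 * 2 ^ k * K * ε ^ 2) by field_simp, div_le_iff₀ (by positivity)]
  linarith

theorem preparations_ge {O : ι → Operator (Fin N)} {ε p : ℝ}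
    (h : A.AccurateWithProb O ε p ∨ A.AccurateInRMS O ε) (hk : 1 ≤ k) (hN : k ≤ N)
    (hp : 1 / 2 < p) (hε : 0 < ε) (hε' : ε ≤ (1 / 4) ^ k / 12)
    (hO : ∀ T : MajoranaIndex N k, ∃ e, (1 / 4) ^ k ≤ ‖(majoranaOp T * O e).trace / 2 ^ N‖) :
    min (preparationConstant k p) (preparationConstant k (3 / 4) / 4) *
      (ε⁻¹ ^ 2 * (N : ℝ) ^ k) ≤ M := by
  choose label hlabel using hO
  have hκ : (0 : ℝ) < (1 / 4) ^ k := by positivity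
  have hpos : 0 ≤ ε⁻¹ ^ 2 * (N : ℝ) ^ k := by positivity
  rcases h with h | h
  · exact (mul_le_mul_of_nonneg_right (min_le_left _ _) hpos).trans
      (h.preparations_ge hk hN hp hε (by linarith) label hlabel)
  · refine (mul_le_mul_of_nonneg_right (min_le_right _ _) hpos).trans (le_trans (le_of_eq ?_)
      ((h.accurateWithProb hε).preparations_ge hk hN (by norm_num) (by positivity) (by linarith)
        label hlabel))
    rw [mul_inv, mul_pow]
    ring

theorem exists_majoranaOp_component (T : MajoranaIndex N k) :
    ∃ e : MajoranaIndex N k, (1 / 4) ^ k ≤ ‖(majoranaOp T * majoranaOp e).trace / 2 ^ N‖ := by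
  refine ⟨T, ?_⟩
  rw [majoranaOp_mul_self, Matrix.trace_one]
  simp only [Fintype.card_pi, Fintype.card_bool, Finset.prod_const, Finset.card_univ,
    Fintype.card_fin, Nat.cast_pow, Nat.cast_ofNat]
  rw [div_self (by positivity), norm_one]
  exact pow_le_one₀ (by norm_num) (by norm_num)

/-! ### Necessary cliques -/

/-- If no circuit of a protocol measures `G_T`, then the protocol cannot tell `(1 + G_T) / 2 ^ N`
from `(1 - G_T) / 2 ^ N`. -/
theorem Protocol.mean_eq_of_not_measured (hk : 1 ≤ k) {T : MajoranaIndex N k}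
    (hT : ∀ K ∈ A.measuredCliques k, majoranaOp T ∉ K)
    (f : (D : DetProtocol N M ι) → (Fin M → Outcome N D.ancillas) → ℝ≥0∞) :
    A.mean (majoranaState T 1) f = A.mean (majoranaState T (-1)) f := by
  have hst : ∀ δ : ℝ, |δ| = 1 → IsFermionState (majoranaState T δ) := fun δ hδ =>
    isFermionState_majoranaState hk T hδ.le
  have hlaw : ∀ D ∈ A.support, ∀ (x : Fin M → Outcome N D.ancillas) (δ : ℝ), |δ| = 1 →
      0 < D.law (majoranaState T δ) x → ∀ δ' : ℝ,
        D.law (majoranaState T δ') x = D.law (majoranaState T δ) x := by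
    intro D hD x δ hδ hpos δ'
    refine Finset.prod_congr rfl fun t _ => ?_
    have hK := hT _ ⟨D, hD, majoranaState T δ, x, t, hst δ hδ, hpos, rfl⟩
    rw [prob_majoranaState, prob_majoranaState,
      (D.circuitAt x t).prob_majoranaOp_eq_zero hK, mul_zero, mul_zero, mul_zero]
  refine tsum_congr fun D => ?_
  by_cases hD : A D = 0
  · rw [hD, zero_mul, zero_mul]
  · refine congrArg (A D * ·) (Finset.sum_congr rfl fun x _ => ?_)
    refine congrArg (fun r => ENNReal.ofReal r * f D x) ?_
    have hD' : D ∈ A.support := (A.mem_support_iff D).mpr hD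
    rcases (D.law_nonneg (hst 1 (by simp)) x).eq_or_lt with h1 | h1
    · rcases (D.law_nonneg (hst (-1) (by simp)) x).eq_or_lt with h2 | h2
      · rw [← h1, ← h2]
      · exact hlaw D hD' x (-1) (by simp) h2 1
    · exact (hlaw D hD' x 1 (by simp) h1 (-1)).symm

/-- A protocol measures every Majorana operator on which one of the estimated expectation values
depends by more than the error. -/
theorem exists_measured_clique (hk : 1 ≤ k) {O : ι → Operator (Fin N)} {ε p : ℝ} (hp : 1 / 2 < p)
    (hε : 0 ≤ ε) (h : A.AccurateWithProb O ε p ∨ A.AccurateInRMS O ε) {T : MajoranaIndex N k}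
    {e : ι} (he : ε < ‖(majoranaOp T * O e).trace / 2 ^ N‖) :
    ∃ K ∈ A.measuredCliques k, majoranaOp T ∈ K := by
  classical
  by_contra! hT
  have hst : ∀ δ : ℝ, |δ| = 1 → IsFermionState (majoranaState T δ) := fun δ hδ =>
    isFermionState_majoranaState hk T hδ.le
  have hs1 := hst 1 (by simp)
  have hs2 := hst (-1) (by simp)
  set a := expectation (majoranaState T 1) (O e) with ha
  set b := expectation (majoranaState T (-1)) (O e) with hb
  have hab : 2 * ε < ‖a - b‖ := by
    rw [ha, hb, expectation_majoranaState, expectation_majoranaState, add_sub_add_left_eq_sub,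
      ← sub_mul, norm_mul]
    have : ‖((1 : ℝ) : ℂ) - ((-1 : ℝ) : ℂ)‖ = 2 := by norm_num
    rw [this]
    linarith
  have htri : ∀ X : ℂ, ‖a - b‖ ≤ ‖X - a‖ + ‖X - b‖ := fun X => by
    have := norm_sub_le (X - b) (X - a)
    rw [sub_sub_sub_cancel_left] at this
    linarith
  rcases h with h | h
  · have h1 := h _ hs1 e
    have h2 := h _ hs2 e
    rw [A.mean_eq_of_not_measured hk hT] at h1
    have h3 := (add_le_add h1 h2)
    rw [← A.mean_add] at h3
    have h4 := h3.trans (A.mean_mono (g := fun _ _ => 1) fun D x => ?_)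
    · rw [A.mean_const hs2, ← ENNReal.ofReal_add (by linarith) (by linarith),
        ENNReal.ofReal_le_one] at h4
      linarith
    · rw [← ha, ← hb]
      have := htri (D.estimate x e)
      split_ifs
      · linarith
      all_goals simp
  · have h1 := h _ hs1 e
    have h2 := h _ hs2 e
    rw [A.mean_eq_of_not_measured hk hT] at h1
    have h3 := (add_le_add h1 h2)
    rw [← A.mean_add] at h3
    have h4 := (A.mean_mono (ρ := majoranaState T (-1))
      (f := fun _ _ => ENNReal.ofReal (‖a - b‖ ^ 2 / 2)) fun D x => ?_).trans h3
    · rw [A.mean_const hs2, ← ENNReal.ofReal_add (sq_nonneg _) (sq_nonneg _),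
        ENNReal.ofReal_le_ofReal_iff (by positivity)] at h4
      nlinarith
    · rw [← ha, ← hb, ← ENNReal.ofReal_add (sq_nonneg _) (sq_nonneg _)]
      apply ENNReal.ofReal_le_ofReal
      have := htri (D.estimate x e)
      nlinarith [sq_nonneg (‖D.estimate x e - a‖ - ‖D.estimate x e - b‖), norm_nonneg (a - b)]

theorem exists_cover_of_measuredCliques (hk : 1 ≤ k) (A : Protocol N M (RDMIndex N k)) {ε p : ℝ}
    (hε' : ε < (1 / 4) ^ k) (hp : 1 / 2 < p) (hε : 0 ≤ ε)
    (h : A.AccurateWithProb rdmOp ε p ∨ A.AccurateInRMS rdmOp ε) {n : ℕ}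
    (hn : (A.measuredCliques k).encard ≤ n) :
    ∃ 𝒞 : Finset (Set (Operator (Fin N))), IsCommutingCliqueCover k 𝒞 ∧ 𝒞.card ≤ n := by
  have hfin : (A.measuredCliques k).Finite := Set.finite_of_encard_le_coe hn
  refine ⟨hfin.toFinset, ⟨?_, fun T => ?_⟩, ?_⟩
  · intro C hC
    obtain ⟨D, -, ρ, x, t, -, -, rfl⟩ := hfin.mem_toFinset.mp hC
    exact (D.circuitAt x t).clique_pairwise_commute k
  · obtain ⟨e, he⟩ := exists_rdm_component T
    obtain ⟨K, hK, hTK⟩ := exists_measured_clique A hk hp hε h (hε'.trans_le he)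
    exact ⟨K, hfin.mem_toFinset.mpr hK, hTK⟩
  · rw [hfin.encard_eq_coe_toFinset_card] at hn
    exact_mod_cast hn

end Protocol

end FermionTomography

open FermionTomography in
theorem theorem1 :
    -- Lower bound on the number `M` of preparations, for the elements of the `k`-RDM and for the
    -- `2k`-Majorana operators; the constants depend only on `k` and the success probability `p`.
    (∀ k : ℕ, 1 ≤ k → ∀ p : ℝ, 1 / 2 < p →
      ∃ c : ℝ, 0 < c ∧ ∃ ε₀ : ℝ, 0 < ε₀ ∧
        ∀ N : ℕ, k ≤ N → ∀ ε : ℝ, 0 < ε → ε ≤ ε₀ → ∀ M : ℕ,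
          (∀ A : Protocol N M (RDMIndex N k),
            (A.AccurateWithProb rdmOp ε p ∨ A.AccurateInRMS rdmOp ε) →
              c * (ε⁻¹ ^ 2 * (N : ℝ) ^ k) ≤ (M : ℝ)) ∧
          (∀ A : Protocol N M (MajoranaIndex N k),
            (A.AccurateWithProb majoranaOp ε p ∨ A.AccurateInRMS majoranaOp ε) →
              c * (ε⁻¹ ^ 2 * (N : ℝ) ^ k) ≤ (M : ℝ))) ∧
    -- Number of commuting cliques needed to contain all 2-Majorana and all 4-Majorana operators.
    (∀ (N : ℕ) (𝒞 : Finset (Set (Operator (Fin N)))), IsCommutingCliqueCover 1 𝒞 →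
      2 * (N : ℝ) - 1 ≤ (𝒞.card : ℝ)) ∧
    (∀ N : ℕ, 8 ≤ N → ∀ 𝒞 : Finset (Set (Operator (Fin N))), IsCommutingCliqueCover 2 𝒞 →
      4 / 3 * (N : ℝ) ^ 2 - 8 / 3 * (N : ℝ) + 1 ≤ (𝒞.card : ℝ)) ∧
    -- The `2k`-Majorana operators measured by one Clifford circuit commute.
    (∀ (N a k : ℕ) (U : CliffordCircuit N a), (U.clique k).Pairwise Commute) ∧
    -- Number of distinct commuting cliques that a protocol must measure to estimate the 1-RDM.
    (∀ (N M : ℕ) (A : Protocol N M (RDMIndex N 1)) (ε p : ℝ), ε < 1 / 4 → 1 / 2 < p → 0 ≤ ε →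
      (A.AccurateWithProb rdmOp ε p ∨ A.AccurateInRMS rdmOp ε) →
        ∀ n : ℕ, (A.measuredCliques 1).encard ≤ (n : ℕ∞) → 2 * (N : ℝ) - 1 ≤ (n : ℝ)) ∧
    -- Number of distinct commuting cliques that a protocol must measure to estimate the 2-RDM.
    (∀ (N M : ℕ) (A : Protocol N M (RDMIndex N 2)) (ε p : ℝ), ε < 1 / 16 → 1 / 2 < p → 0 ≤ ε →
      8 ≤ N → (A.AccurateWithProb rdmOp ε p ∨ A.AccurateInRMS rdmOp ε) →
        ∀ n : ℕ, (A.measuredCliques 2).encard ≤ (n : ℕ∞) →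
          4 / 3 * (N : ℝ) ^ 2 - 8 / 3 * (N : ℝ) + 1 ≤ (n : ℝ)) := by
  refine ⟨fun k hk p hp => ?_, fun N 𝒞 h => card_cover_one h, fun N hN 𝒞 h => card_cover_two hN h,
    fun N a k U => U.clique_pairwise_commute k, ?_, ?_⟩
  · refine ⟨min (preparationConstant k p) (preparationConstant k (3 / 4) / 4),
      lt_min (preparationConstant_pos hk hp)
        (div_pos (preparationConstant_pos hk (by norm_num)) (by norm_num)),
      (1 / 4) ^ k / 12, by positivity, fun N hN ε hε hε' M => ⟨fun A h => ?_, fun A h => ?_⟩⟩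
    · exact preparations_ge A h hk hN hp hε hε' exists_rdm_component
    · exact preparations_ge A h hk hN hp hε hε' exists_majoranaOp_component
  · intro N M A ε p hε' hp hε h n hn
    obtain ⟨𝒞, h𝒞, hcard⟩ :=
      exists_cover_of_measuredCliques le_rfl A (by rwa [pow_one]) hp hε h hn
    exact (card_cover_one h𝒞).trans (by exact_mod_cast hcard)
  · intro N M A ε p hε' hp hε hN h n hn
    obtain ⟨𝒞, h𝒞, hcard⟩ :=
      exists_cover_of_measuredCliques one_le_two A (hε'.trans_eq (by norm_num)) hp hε h hn
    exact (card_cover_two hN h𝒞).trans (by exact_mod_cast hcard)
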